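/- Let $n\ge 3$ be odd and let $D$ be the doubled regular $n$-gon, that is, the metric space obtained by gluing two copies of a regular $n$-gon (with its interior) along their common boundary; $D$ is flat away from $n$ cone points, the vertices. A geodesic net in $D$ modeled on a finite multigraph $G$ is an embedding of $G$ in $D$ such that each edge is a (locally distance-realizing) geodesic and at each vertex, which must lie at a flat point, the unit tangent vectors to the edges sum to zero (a loop contributes two vectors). The figure-eight graph is the graph with one vertex and two loops. Then $D$ admits a geodesic net modeled on the figure-eight graph. More precisely, for every side $e$ of the polygon, with midpoint $M$, there are $\ell>0$ and a closed unit-speed geodesic $\gamma:\mathbb R\to D$ of period $2\ell$ that avoids the cone points, such that: 1. $\gamma(0)=\gamma(\ell)=M$, and this is the only self-intersection of $\gamma$ (for $0\le s<t<2\ell$, $\gamma(s)=\gamma(t)$ if and only if $s=0$ and $t=\ell$); 2. $\gamma|_{[0,\ell]}$ and $\gamma|_{[\ell,2\ell]}$ are the two loops of a geodesic net in $D$ modeled on the figure-eight graph, with vertex $M$; 3. if the sides are numbered cyclically starting with $e$ as side $0$, then $\gamma$ crosses the far side number $(n-1)/2$ perpendicularly at time $\ell/2$ and the far side number $(n+1)/2$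 perpendicularly at time $3\ell/2$ (these are the two sides that meet at the vertex opposite to $e$), in both cases at an interior point of the side; 4. the loop $\gamma|_{[0,\ell]}$ does not close up smoothly at $M$, and $\gamma(\ell+t)$ is, for every $t\in\mathbb R$, the mirror image of $\gamma(t)$ on the same face under the reflection in the axis of the polygon through $M$. -/

import Mathlib

open Set

noncomputable section

/-! ### Geodesics and geodesic nets in a metric space -/

/-- `γ` is a unit-speed geodesic on `s ⊆ ℝ`: locally distance-realizing at every time in `s`. -/
def IsGeodesicOn {X : Type*} [MetricSpace X] (γ : ℝ → X) (s : Set ℝ) : Prop :=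
  ∀ t ∈ s, ∃ ε > 0, ∀ a ∈ s, ∀ b ∈ s, |a - t| < ε → |b - t| < ε → dist (γ a) (γ b) = |a - b|

/-- A closed unit-speed geodesic of length `L`: a periodic geodesic line, so that it also closes
up smoothly. -/
def IsClosedGeodesic {X : Type*} [MetricSpace X] (γ : ℝ → X) (L : ℝ) : Prop :=
  0 < L ∧ Function.Periodic γ L ∧ IsGeodesicOn γ univ

/-- Two unit-speed arcs leaving a common point fit together, at that point, to one geodesic. -/
def JoinSmoothly {X : Type*} [MetricSpace X] (α β : ℝ → X) : Prop :=
  ∃ ε > 0, ∀ s ∈ Ico 0 ε, ∀ t ∈ Ico 0 ε, dist (α s) (β t) = s + t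

/-- `φ` maps the Euclidean disk of radius `r` about `0` isometrically onto the ball of radius `r`
about `x`. Points that have such a chart are the flat (nonsingular) points, and the plane `ℂ`
serves as the tangent plane there. -/
structure IsFlatChart {X : Type*} [MetricSpace X] (φ : ℂ → X) (r : ℝ) (x : X) : Prop where
  pos : 0 < r
  map_zero : φ 0 = x
  isometry : ∀ z ∈ Metric.ball (0 : ℂ) r, ∀ w ∈ Metric.ball (0 : ℂ) r, dist (φ z) (φ w) = dist z w
  image : φ '' Metric.ball 0 r = Metric.ball x r

/-- In the flat chart `φ` at `α 0`, the geodesic arc `α` leaves in the direction of the unit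
vector `u`, i.e. it is the straight ray with direction `u` for a short time. -/
def HasUnitTangent {X : Type*} (φ : ℂ → X) (α : ℝ → X) (u : ℂ) : Prop :=
  ‖u‖ = 1 ∧ ∃ δ > 0, ∀ t ∈ Icc 0 δ, α t = φ (t • u)

/-- A geodesic net in `X` modeled on the finite multigraph `G`: an embedding of `G` in `X` such
that each edge is a geodesic and at each vertex the unit tangent vectors to the edges (one for
each edge end at the vertex, so two for a loop) sum to zero. -/
structure GeodesicNet (X : Type*) [MetricSpace X] {V E : Type*} [Fintype E] (G : Graph V E) where
  /-- position of the vertices -/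
  pos : V → X
  /-- start (`false`) and end (`true`) of each edge -/
  ends : E → Bool → V
  /-- length of the edges -/
  len : E → ℝ
  /-- unit-speed parametrization of the edge `e` on `[0, len e]` -/
  curve : E → ℝ → X
  isLink : ∀ e ∈ G.edgeSet, G.IsLink e (ends e false) (ends e true)
  len_pos : ∀ e ∈ G.edgeSet, 0 < len e
  curve_start : ∀ e ∈ G.edgeSet, curve e 0 = pos (ends e false)
  curve_end : ∀ e ∈ G.edgeSet, curve e (len e) = pos (ends e true)
  geodesic : ∀ e ∈ G.edgeSet, IsGeodesicOn (curve e) (Icc 0 (len e))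
  pos_injOn : InjOn pos G.vertexSet
  curve_inj : ∀ e ∈ G.edgeSet, ∀ e' ∈ G.edgeSet, ∀ s ∈ Ioo 0 (len e), ∀ t ∈ Ioo 0 (len e'),
    curve e s = curve e' t → e = e' ∧ s = t
  curve_ne_pos : ∀ e ∈ G.edgeSet, ∀ s ∈ Ioo 0 (len e), ∀ v ∈ G.vertexSet, curve e s ≠ pos v
  balanced : ∀ v ∈ G.vertexSet, ∃ (φ : ℂ → X) (r : ℝ) (τ : E × Bool → ℂ),
    IsFlatChart φ r (pos v) ∧
    (∀ e ∈ G.edgeSet, ends e false = v → HasUnitTangent φ (curve e) (τ (e, false))) ∧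
    (∀ e ∈ G.edgeSet, ends e true = v →
      HasUnitTangent φ (fun t => curve e (len e - t)) (τ (e, true))) ∧
    ∑ h : E × Bool, {h : E × Bool | h.1 ∈ G.edgeSet ∧ ends h.1 h.2 = v}.indicator τ h = 0

/-- The figure-eight graph: one vertex and two loops. -/
def figureEight : Graph Unit (Fin 2) := Graph.bouquet () univ

/-! ### Doubled polygons -/

/-- The regular `n`-gon with center `c` and first vertex `c + w`, labeled counterclockwise. -/
def regularPolygon (n : ℕ) (c w : ℂ) : Polygon ℂ n :=
  ⟨fun k => c + w * Complex.exp (2 * Real.pi * Complex.I * ((k : ℕ) : ℂ) / (n : ℂ))⟩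

/-- The closed region bounded by a convex polygon. -/
def polygonRegion {n : ℕ} (p : Polygon ℂ n) : Set ℂ := convexHull ℝ (range p.vertices)

theorem vertex_mem_polygonRegion {n : ℕ} (p : Polygon ℂ n) (k : Fin n) :
    p k ∈ polygonRegion p :=
  subset_convexHull ℝ _ (mem_range_self k)

/-- The boundary of a convex polygon (the union of its sides), as a part of the region. -/
abbrev PolygonBoundary {n : ℕ} (p : Polygon ℂ n) : Type :=
  {x : polygonRegion p // (x : ℂ) ∈ p.boundary ℝ}

instance {n : ℕ} [NeZero n] (p : Polygon ℂ n) : Nonempty (PolygonBoundary p) :=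
  ⟨⟨⟨p 0, vertex_mem_polygonRegion p 0⟩,
    mem_iUnion.2 ⟨0, left_mem_affineSegment ℝ (p 0) (p (finRotate n 0))⟩⟩⟩

/-- The doubled (convex) polygon: two copies of the region glued along their common boundary. -/
def DoubledPolygon {n : ℕ} [NeZero n] (p : Polygon ℂ n) : Type :=
  Metric.GlueSpace (Z := PolygonBoundary p)
    (isometry_subtype_coe : Isometry (Subtype.val : PolygonBoundary p → polygonRegion p))
    (isometry_subtype_coe : Isometry (Subtype.val : PolygonBoundary p → polygonRegion p))

namespace DoubledPolygon

variable {n : ℕ} [NeZero n] {p : Polygon ℂ n}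

instance : MetricSpace (DoubledPolygon p) :=
  inferInstanceAs (MetricSpace (Metric.GlueSpace _ _))

/-- The inclusions of the two copies of the polygon, `false` for the front, `true` for the back. -/
def face : Bool → polygonRegion p → DoubledPolygon p
  | false => Metric.toGlueL _ _
  | true => Metric.toGlueR _ _

/-- The cone points, which are the vertices of the polygon. -/
def conePoint (k : Fin n) : DoubledPolygon p :=
  face false ⟨p k, vertex_mem_polygonRegion p k⟩

/-- The midpoint of the `i`-th side, the one from vertex `i` to vertex `i + 1`. -/
def sideMidpoint (i : Fin n) : DoubledPolygon p :=
  face false ⟨midpoint ℝ (p i) (p (finRotate n i)),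
    (convex_convexHull ℝ _).midpoint_mem (vertex_mem_polygonRegion p i)
      (vertex_mem_polygonRegion p _)⟩

/-- At time `t₀` the curve `γ` crosses the `j`-th side perpendicularly, at an interior point `q` of
that side, from one face to the other. In both faces it then runs, near `q`, along the
segment that leaves `q` in the direction `u` orthogonal to the side. -/
def CrossesPerpendicularly (γ : ℝ → DoubledPolygon p) (j : Fin n) (t₀ : ℝ) : Prop :=
  ∃ q ∈ openSegment ℝ (p j) (p (finRotate n j)), ∃ u : ℂ, ‖u‖ = 1 ∧
    inner ℝ u (p (finRotate n j) - p j) = 0 ∧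
    ∃ (s : Bool) (ε : ℝ), 0 < ε ∧ ∀ t ∈ Icc 0 ε, ∃ h : q + t • u ∈ polygonRegion p,
      γ (t₀ - t) = face s ⟨q + t • u, h⟩ ∧ γ (t₀ + t) = face (!s) ⟨q + t • u, h⟩

end DoubledPolygon

/-- The reflection of the plane in the line through `c` and `m` (for `m ≠ c`). -/
def axisReflection (c m z : ℂ) : ℂ := c + (m - c) * starRingEnd ℂ ((z - c) / (m - c))

end

/-! Let `M` be the midpoint of a side and `θ = π / n`. Since `n` is odd, the two rays from `M` that
make the angles `±θ` with the axis towards the center hit the two far sides at right angles, at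
interior points. Follow one of them on the front face. Having met the far side perpendicularly, the
geodesic continues on the back face along the same segment backwards and returns to `M`. There it
passes to the front face again, and unfolding across the side mirrors its direction in the axis, so
that it leaves along the other ray. After a second such trip the curve closes up smoothly. Each trip
is a loop at `M`. In the tangent plane the four loop ends have directions `±v` and `±conj v`, so
they sum to zero; that `v` is not orthogonal to the side keeps the two loops apart and gives each of
them a corner at `M`.

The two segments share only `M`, their interiors avoid the boundary, and the faces meet only along
the boundary. Hence there is no other self-intersection (`arc_injective`, `curve_eq_curve_iff`).

Inside a face the curve is straight, and faces are isometrically embedded. At `M` and at the feet of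
the perpendiculars, `exists_isFlatChart_unfold` unfolds the two faces to a Euclidean disk, using the
half-disks of `exists_halfDisk`; in these charts the curve is a straight line
(`curve_near_midpoint`, `curve_near_foot`).

Regularity enters only through `isStrictlyConvex_regularPolygon` and
`exists_mirrorPair_regularPolygon`; the curve and the net are built for any strictly convex polygon
with a `MirrorPair`. -/

namespace DoubledPolygon

/-! ### Distances and identifications in the doubled polygon -/

variable {n : ℕ} {p : Polygon ℂ n}

theorem boundary_subset_region : p.boundary ℝ ⊆ polygonRegion p := by
  intro z hz
  obtain ⟨k, hk⟩ := mem_iUnion.1 hz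
  rw [Polygon.edgeSet, affineSegment_eq_segment] at hk
  exact (convex_convexHull ℝ _).segment_subset (vertex_mem_polygonRegion p _)
    (vertex_mem_polygonRegion p _) hk

theorem isClosed_edgeSet (k : Fin n) : IsClosed (p.edgeSet ℝ k) := by
  rw [Polygon.edgeSet_eq_image_edgePath]
  exact (isCompact_Icc.image (AffineMap.continuous_of_finiteDimensional _)).isClosed

theorem isClosed_boundary : IsClosed (p.boundary ℝ) :=
  isClosed_iUnion_of_finite isClosed_edgeSet

variable [NeZero n]

theorem dist_face (s : Bool) (x y : polygonRegion p) :
    dist (face s x) (face s y) = dist (x : ℂ) y := by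
  cases s
  · exact (Metric.toGlueL_isometry _ _).dist_eq x y
  · exact (Metric.toGlueR_isometry _ _).dist_eq x y

theorem face_false_eq_face_true {x : polygonRegion p} (hx : (x : ℂ) ∈ p.boundary ℝ) :
    face false x = face true x :=
  congrFun (Metric.toGlue_commute (Z := PolygonBoundary p) (isometry_subtype_coe :
    Isometry (Subtype.val : PolygonBoundary p → polygonRegion p)) isometry_subtype_coe) ⟨x, hx⟩

theorem dist_face_false_face_true (x y : polygonRegion p) :
    dist (face false x) (face true y) =
      ⨅ b : PolygonBoundary p, (dist (x : ℂ) b + dist (y : ℂ) b) := by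
  -- The summand `0` is the gap parameter of the gluing metric.
  have : dist (face false x) (face true y) =
      (⨅ b : PolygonBoundary p, (dist (x : ℂ) b + dist (y : ℂ) b)) + 0 := rfl
  rw [this, add_zero]

/-- Distances between the two faces are bounded below by the lengths of broken lines through the
boundary. -/
theorem le_dist_face {C : ℝ} (x y : polygonRegion p)
    (h : ∀ b ∈ p.boundary ℝ, C ≤ dist (x : ℂ) b + dist (y : ℂ) b) :
    C ≤ dist (face false x) (face true y) := by
  rw [dist_face_false_face_true]
  exact le_ciInf fun b => h _ b.2

theorem dist_face_le (x y : polygonRegion p) {b : ℂ} (hb : b ∈ p.boundary ℝ) :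
    dist (face false x) (face true y) ≤ dist (x : ℂ) b + dist (y : ℂ) b := by
  rw [dist_face_false_face_true]
  exact ciInf_le ⟨0, forall_mem_range.2 fun _ => by positivity⟩
    (⟨⟨b, boundary_subset_region hb⟩, hb⟩ : PolygonBoundary p)

/-- At distance zero there are arbitrarily short broken lines from `x` to `y` through the boundary.
So `x` and `y` coincide, and as the boundary is closed it contains them. -/
theorem face_false_eq_face_true_imp {x y : polygonRegion p} (h : face false x = face true y) :
    x = y ∧ (x : ℂ) ∈ p.boundary ℝ := by
  have key : ∀ ε > 0, ∃ b ∈ p.boundary ℝ, dist (x : ℂ) b + dist (y : ℂ) b < ε := by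
    intro ε hε
    by_contra! hc
    have := le_dist_face x y hc
    rw [h, dist_self] at this
    linarith
  have hx : (x : ℂ) ∈ p.boundary ℝ := by
    rw [← isClosed_boundary.closure_eq, Metric.mem_closure_iff]
    intro ε hε
    obtain ⟨b, hb, hlt⟩ := key ε hε
    exact ⟨b, hb, by linarith [dist_nonneg (x := (y : ℂ)) (y := b)]⟩
  refine ⟨Subtype.ext (dist_le_zero.1 (le_of_forall_pos_le_add fun ε hε => ?_)), hx⟩
  obtain ⟨b, hb, hlt⟩ := key ε hε
  linarith [dist_triangle_right (x : ℂ) y b]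

theorem face_eq_face_imp {s t : Bool} {x y : polygonRegion p} (h : face s x = face t y) :
    x = y ∧ (s = t ∨ (x : ℂ) ∈ p.boundary ℝ) := by
  have same : ∀ s, face s x = face s y → x = y := fun s h => Subtype.ext <| by
    rw [← dist_eq_zero, ← dist_face s, h, dist_self]
  cases s <;> cases t
  · exact ⟨same _ h, Or.inl rfl⟩
  · exact ⟨(face_false_eq_face_true_imp h).1, Or.inr (face_false_eq_face_true_imp h).2⟩
  · obtain ⟨h1, h2⟩ := face_false_eq_face_true_imp h.symm
    exact ⟨h1.symm, Or.inr (h1 ▸ h2)⟩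
  · exact ⟨same _ h, Or.inl rfl⟩

open Classical in
/-- The point of the face `s` over the point `z` of the plane (a junk value outside the region). -/
noncomputable def facePoint (p : Polygon ℂ n) (s : Bool) (z : ℂ) : DoubledPolygon p :=
  if h : z ∈ polygonRegion p then face s ⟨z, h⟩ else conePoint 0

theorem facePoint_of_mem (s : Bool) {z : ℂ} (h : z ∈ polygonRegion p) :
    facePoint p s z = face s ⟨z, h⟩ := dif_pos h

theorem dist_facePoint (s : Bool) {z z' : ℂ} (h : z ∈ polygonRegion p)
    (h' : z' ∈ polygonRegion p) : dist (facePoint p s z) (facePoint p s z') = dist z z' := by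
  rw [facePoint_of_mem s h, facePoint_of_mem s h', dist_face]

theorem facePoint_eq_of_mem_boundary (s t : Bool) {z : ℂ} (h : z ∈ p.boundary ℝ) :
    facePoint p s z = facePoint p t z := by
  have := face_false_eq_face_true (x := ⟨z, boundary_subset_region h⟩) h
  cases s <;> cases t <;> simp [facePoint_of_mem _ (boundary_subset_region h), this]

theorem facePoint_eq_imp {s t : Bool} {z z' : ℂ} (h : z ∈ polygonRegion p)
    (h' : z' ∈ polygonRegion p) (he : facePoint p s z = facePoint p t z') :
    z = z' ∧ (s = t ∨ z ∈ p.boundary ℝ) := by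
  rw [facePoint_of_mem s h, facePoint_of_mem t h'] at he
  obtain ⟨h1, h2⟩ := face_eq_face_imp he
  exact ⟨congrArg Subtype.val h1, h2⟩

theorem exists_eq_facePoint (x : DoubledPolygon p) :
    ∃ s, ∃ z ∈ polygonRegion p, x = facePoint p s z := by
  have : ∃ (s : Bool) (z : polygonRegion p), x = face s z := by
    obtain ⟨z | z, rfl⟩ := Quotient.exists_rep x
    · exact ⟨false, z, rfl⟩
    · exact ⟨true, z, rfl⟩
  obtain ⟨s, z, rfl⟩ := this
  exact ⟨s, z, z.2, (facePoint_of_mem s z.2).symm⟩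

end DoubledPolygon

/-! ### Strictly convex polygons -/

namespace DoubledPolygon

variable {n : ℕ} {p : Polygon ℂ n}

/-- The affine form that vanishes on the `k`-th side and is positive to the left of it. -/
def sideForm (p : Polygon ℂ n) (k : Fin n) (z : ℂ) : ℝ :=
  ((z - p k) * starRingEnd ℂ (p (finRotate n k) - p k)).im

/-- A polygon is strictly convex (and oriented counterclockwise) if all vertices off a side lie
strictly to the left of it. -/
def IsStrictlyConvex (p : Polygon ℂ n) : Prop :=
  ∀ k l, l ≠ k → l ≠ finRotate n k → 0 < sideForm p k (p l)

@[simp] theorem sideForm_left (k : Fin n) : sideForm p k (p k) = 0 := by simp [sideForm]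

theorem sideForm_right (k : Fin n) : sideForm p k (p (finRotate n k)) = 0 := by
  rw [sideForm, Complex.mul_conj, Complex.ofReal_im]

theorem sideForm_combo (k : Fin n) (x y : ℂ) {a b : ℝ} (h : a + b = 1) :
    sideForm p k (a • x + b • y) = a * sideForm p k x + b * sideForm p k y := by
  obtain rfl : b = 1 - a := by linarith
  simp only [sideForm, Complex.mul_im, Complex.sub_re, Complex.sub_im, Complex.add_re,
    Complex.add_im, Complex.conj_re, Complex.conj_im, Complex.smul_re, Complex.smul_im,
    smul_eq_mul]
  ring

theorem continuous_sideForm (k : Fin n) : Continuous (sideForm p k) := by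
  unfold sideForm
  fun_prop

theorem sideForm_eq_zero_of_mem_edgeSet {k : Fin n} {z : ℂ} (hz : z ∈ p.edgeSet ℝ k) :
    sideForm p k z = 0 := by
  rw [Polygon.edgeSet, affineSegment_eq_segment] at hz
  obtain ⟨a, b, -, -, hab, rfl⟩ := hz
  rw [sideForm_combo k _ _ hab, sideForm_left, sideForm_right]
  ring

theorem finRotate_ne_self (h3 : 3 ≤ n) (k : Fin n) : finRotate n k ≠ k := by
  have : NeZero n := ⟨by omega⟩
  rw [finRotate_apply, Ne, Fin.ext_iff, Fin.val_add, Fin.val_one',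
    Nat.mod_eq_of_lt (a := 1) (by omega)]
  have := k.2
  rcases Nat.lt_or_ge (k + 1) n with h | h
  · rw [Nat.mod_eq_of_lt h]; omega
  · rw [show (k : ℕ) + 1 = n by omega, Nat.mod_self]; omega

theorem finRotate_finRotate_ne_self (h3 : 3 ≤ n) (k : Fin n) :
    finRotate n (finRotate n k) ≠ k := by
  have : NeZero n := ⟨by omega⟩
  rw [finRotate_apply, finRotate_apply, Ne, Fin.ext_iff, add_assoc, Fin.val_add, Fin.val_add,
    Fin.val_one', Nat.mod_eq_of_lt (a := 1) (by omega), Nat.mod_eq_of_lt (a := 1 + 1) (by omega)]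
  have := k.2
  rcases Nat.lt_or_ge (k + (1 + 1)) n with h | h
  · rw [Nat.mod_eq_of_lt h]; omega
  · rw [Nat.mod_eq_sub_mod h, Nat.mod_eq_of_lt (by omega)]; omega

namespace IsStrictlyConvex

variable (hp : IsStrictlyConvex p)

include hp

theorem sideForm_vertex_nonneg (k l : Fin n) : 0 ≤ sideForm p k (p l) := by
  by_cases h1 : l = k
  · simp [h1]
  by_cases h2 : l = finRotate n k
  · rw [h2, sideForm_right]
  exact (hp k l h1 h2).le

theorem sideForm_nonneg (k : Fin n) {z : ℂ} (hz : z ∈ polygonRegion p) : 0 ≤ sideForm p k z := by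
  have hc : Convex ℝ {z | 0 ≤ sideForm p k z} := by
    intro x hx y hy a b ha hb hab
    change 0 ≤ sideForm p k _
    rw [sideForm_combo k x y hab]
    exact add_nonneg (mul_nonneg ha hx) (mul_nonneg hb hy)
  exact convexHull_min (t := {z | 0 ≤ sideForm p k z})
    (range_subset_iff.2 (hp.sideForm_vertex_nonneg k)) hc hz

/-- The form is affine and nonnegative at both ends of side `i`. As the sides differ, one of these
ends is off side `k`, and there it is positive. -/
theorem sideForm_pos_of_mem_openSegment (h3 : 3 ≤ n) {i k : Fin n} (hik : k ≠ i) {q : ℂ}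
    (hq : q ∈ openSegment ℝ (p i) (p (finRotate n i))) : 0 < sideForm p k q := by
  obtain ⟨a, b, ha, hb, hab, rfl⟩ := hq
  rw [sideForm_combo k _ _ hab]
  have h1 := hp.sideForm_vertex_nonneg k i
  have h2 := hp.sideForm_vertex_nonneg k (finRotate n i)
  by_cases h : i = finRotate n k
  · have h4 : 0 < sideForm p k (p (finRotate n i)) :=
      hp k _ (by rw [h]; exact finRotate_finRotate_ne_self h3 k)
        (fun h' => hik ((finRotate n).injective h').symm)
    positivity
  · have h4 : 0 < sideForm p k (p i) := hp k _ (Ne.symm hik) h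
    positivity

theorem eq_index_of_sideForm_eq_zero (h3 : 3 ≤ n) {i k : Fin n} {q : ℂ}
    (hq : q ∈ openSegment ℝ (p i) (p (finRotate n i))) (h : sideForm p k q = 0) : k = i := by
  by_contra hki
  exact (hp.sideForm_pos_of_mem_openSegment h3 hki hq).ne' h

theorem side_ne_zero (h3 : 3 ≤ n) (k : Fin n) : p (finRotate n k) - p k ≠ 0 := by
  intro h
  have := hp k _ (finRotate_finRotate_ne_self h3 k) (finRotate_ne_self h3 _)
  rw [sideForm, h, map_zero, mul_zero, Complex.zero_im] at this
  exact this.false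

/-- Near an interior point of a side, the region is the half-plane to the left of that side. -/
theorem exists_halfDisk (h3 : 3 ≤ n) {j : Fin n} {q : ℂ}
    (hq : q ∈ openSegment ℝ (p j) (p (finRotate n j))) :
    ∃ ρ > 0, ∀ z ∈ Metric.ball q ρ, (0 ≤ sideForm p j z → z ∈ polygonRegion p) ∧
      (z ∈ p.boundary ℝ ↔ sideForm p j z = 0) := by
  set l := finRotate n (finRotate n j)
  set e := p (finRotate n j) - p j with he
  have he0 : e ≠ 0 := hp.side_ne_zero h3 j
  have hV : 0 < sideForm p j (p l) :=
    hp j l (finRotate_finRotate_ne_self h3 j) (finRotate_ne_self h3 _)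
  -- `β` and `B` are barycentric coordinates in the triangle of three consecutive vertices, the two
  -- ends of side `j` and the next vertex `p l`. At `q` the coordinates of the two ends are positive
  -- and `β` vanishes, so near `q` only the sign of `β` decides membership in the triangle.
  let β : ℂ → ℝ := fun z => sideForm p j z / sideForm p j (p l)
  let B : ℂ → ℝ := fun z =>
    ((z - p j - β z * (p l - p j)) * starRingEnd ℂ e).re / Complex.normSq e
  have hn0 : (Complex.normSq e : ℂ) ≠ 0 := by simpa using he0
  have hβ : Continuous β := (continuous_sideForm j).div_const _
  have hB : Continuous B := by fun_prop
  have hz : ∀ z, z = (1 - B z - β z) • p j + B z • p (finRotate n j) + β z • p l := by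
    intro z
    have him : ((z - p j - β z * (p l - p j)) * starRingEnd ℂ e).im = 0 := by
      have : ((z - p j - β z * (p l - p j)) * starRingEnd ℂ e).im =
          sideForm p j z - β z * sideForm p j (p l) := by
        simp only [sideForm, ← he, Complex.mul_im, Complex.mul_re, Complex.sub_re, Complex.sub_im,
          Complex.ofReal_re, Complex.ofReal_im]
        ring
      rw [this, div_mul_cancel₀ _ hV.ne', sub_self]
    have h1 : (B z : ℂ) * Complex.normSq e =
        (z - p j - β z * (p l - p j)) * starRingEnd ℂ e := by
      rw [← Complex.ofReal_mul, div_mul_cancel₀ _ (by exact_mod_cast hn0)]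
      exact Complex.ext rfl (by rw [him, Complex.ofReal_im])
    rw [← Complex.mul_conj, ← mul_assoc] at h1
    have h2 := mul_right_cancel₀ ((map_ne_zero (starRingEnd ℂ)).2 he0) h1
    simp only [Complex.real_smul]
    push_cast
    linear_combination (norm := (rw [he]; ring)) -h2
  obtain ⟨a, b, ha, hb, hab, hqab⟩ := id hq
  have hSq : sideForm p j q = 0 := by
    rw [← hqab, sideForm_combo j _ _ hab, sideForm_left, sideForm_right]; ring
  have hβq : β q = 0 := by simp [β, hSq]
  have hBq : B q = b := by
    have h1 := hz q
    generalize B q = B' at h1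
    rw [hβq, ← hqab] at h1
    have : ((b - B' : ℝ) : ℂ) * e = 0 := by
      obtain rfl : a = 1 - b := by linarith
      simp only [Complex.real_smul, sub_zero, zero_smul, add_zero] at h1
      push_cast at h1 ⊢
      rw [he]
      linear_combination h1
    have := (mul_eq_zero.1 this).resolve_right he0
    have := Complex.ofReal_eq_zero.1 this
    linarith
  have e1 : ∀ᶠ z in nhds q, 0 < B z := hB.continuousAt.eventually_const_lt (by rw [hBq]; exact hb)
  have e2 : ∀ᶠ z in nhds q, 0 < 1 - B z - β z :=
    ((continuous_const.sub hB).sub hβ).continuousAt.eventually_const_lt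
      (show 0 < 1 - B q - β q by linarith)
  -- The other sides are closed, finite in number and miss `q`, so near `q` the boundary is side `j`
  -- alone.
  have e3 : ∀ᶠ z in nhds q, ∀ k, k ≠ j → z ∉ p.edgeSet ℝ k := by
    rw [Filter.eventually_all]
    intro k
    by_cases hk : k = j
    · simp [hk]
    · have : q ∉ p.edgeSet ℝ k := fun h =>
        (hp.sideForm_pos_of_mem_openSegment h3 hk hq).ne' (sideForm_eq_zero_of_mem_edgeSet h)
      filter_upwards [(isClosed_edgeSet k).isOpen_compl.mem_nhds this] with z hz _ using hz
  obtain ⟨ρ, hρ, hball⟩ := Metric.eventually_nhds_iff_ball.1 (e1.and (e2.and e3))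
  refine ⟨ρ, hρ, fun z hzb => ?_⟩
  obtain ⟨h1, h2, h4⟩ := hball z hzb
  refine ⟨fun h => ?_, fun h => ?_, fun h => ?_⟩
  · have h0 : 0 ≤ β z := div_nonneg h hV.le
    have key := (convex_convexHull ℝ (range p.vertices)).sum_mem (t := Finset.univ)
      (w := ![1 - B z - β z, B z, β z]) (z := ![p j, p (finRotate n j), p l])
      (fun i _ => by fin_cases i; exacts [h2.le, h1.le, h0])
      (by simp [Fin.sum_univ_three]; ring)
      (fun i _ => by
        fin_cases i
        exacts [vertex_mem_polygonRegion p _, vertex_mem_polygonRegion p _,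
          vertex_mem_polygonRegion p _])
    rw [Fin.sum_univ_three] at key
    rw [hz z]
    exact key
  · obtain ⟨k, hk⟩ := mem_iUnion.1 h
    by_cases hkj : k = j
    · exact sideForm_eq_zero_of_mem_edgeSet (hkj ▸ hk)
    · exact absurd hk (h4 k hkj)
  · refine mem_iUnion.2 ⟨j, ?_⟩
    have hb0 : β z = 0 := by simp [β, h]
    rw [Polygon.edgeSet, affineSegment_eq_segment]
    refine ⟨1 - B z, B z, by linarith, h1.le, by ring, ?_⟩
    conv_rhs => rw [hz z, hb0]
    simp

/-- No side `k` can contain both `q` and `q'`. So its affine form, nonnegative at both points, is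
positive at one of them and hence strictly between them. -/
theorem not_mem_boundary_of_mem_openSegment (h3 : 3 ≤ n) {i j : Fin n} (hij : i ≠ j) {q q' z : ℂ}
    (hq : q ∈ openSegment ℝ (p i) (p (finRotate n i)))
    (hq' : q' ∈ openSegment ℝ (p j) (p (finRotate n j))) (hz : z ∈ openSegment ℝ q q') :
    z ∉ p.boundary ℝ := by
  intro h
  obtain ⟨k, hk⟩ := mem_iUnion.1 h
  have h0 := sideForm_eq_zero_of_mem_edgeSet hk
  obtain ⟨a, b, ha, hb, hab, rfl⟩ := hz
  rw [sideForm_combo k _ _ hab] at h0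
  have region : ∀ {i : Fin n} {q : ℂ}, q ∈ openSegment ℝ (p i) (p (finRotate n i)) →
      0 ≤ sideForm p k q := fun h => hp.sideForm_nonneg k
    ((convex_convexHull ℝ _).openSegment_subset (vertex_mem_polygonRegion p _)
      (vertex_mem_polygonRegion p _) h)
  have h1 := region hq
  have h2 := region hq'
  by_cases hki : k = i
  · have := hp.sideForm_pos_of_mem_openSegment h3 (hki ▸ hij) hq'
    have : 0 < a * sideForm p k q + b * sideForm p k q' := by positivity
    exact this.ne' h0
  · have := hp.sideForm_pos_of_mem_openSegment h3 hki hq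
    have : 0 < a * sideForm p k q + b * sideForm p k q' := by positivity
    exact this.ne' h0

/-- A vertex lies on two sides, an interior point of a side on just one. -/
theorem ne_vertex_of_mem_openSegment (h3 : 3 ≤ n) {i : Fin n} {q : ℂ}
    (hq : q ∈ openSegment ℝ (p i) (p (finRotate n i))) (k : Fin n) : q ≠ p k := by
  rintro rfl
  have h1 := hp.eq_index_of_sideForm_eq_zero h3 hq (sideForm_left k)
  subst h1
  have h2 : finRotate n ((finRotate n).symm k) = k := Equiv.apply_symm_apply _ _
  have h4 : sideForm p ((finRotate n).symm k) (p k) = 0 := by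
    nth_rw 2 [← h2]
    exact sideForm_right _
  have := hp.eq_index_of_sideForm_eq_zero h3 hq h4
  rw [this] at h2
  exact finRotate_ne_self h3 k h2

end IsStrictlyConvex
end DoubledPolygon

/-! ### Flat charts from unfolding the two faces across a side -/

/-- The reflection of the lower half-plane onto the upper one. -/
def foldUp (z : ℂ) : ℂ := ⟨z.re, |z.im|⟩

theorem norm_foldUp (z : ℂ) : ‖foldUp z‖ = ‖z‖ := by
  simp [Complex.norm_eq_sqrt_sq_add_sq, foldUp]

theorem foldUp_of_nonneg {z : ℂ} (h : 0 ≤ z.im) : foldUp z = z :=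
  Complex.ext rfl (abs_of_nonneg h)

theorem foldUp_of_nonpos {z : ℂ} (h : z.im ≤ 0) : foldUp z = starRingEnd ℂ z :=
  Complex.ext rfl (abs_of_nonpos h)

theorem dist_foldUp_of_im_eq_zero (z : ℂ) {x : ℂ} (hx : x.im = 0) :
    dist (foldUp z) x = dist z x := by
  simp [Complex.dist_eq_re_im, foldUp, hx]

theorem dist_foldUp_of_nonpos {z z' : ℂ} (h : z.im ≤ 0) (h' : z'.im ≤ 0) :
    dist (foldUp z) (foldUp z') = dist z z' := by
  rw [foldUp_of_nonpos h, foldUp_of_nonpos h', Complex.dist_conj_conj]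

/-- A segment from the upper half-plane to the lower one crosses the real axis. -/
theorem exists_im_eq_zero_mem_segment {z z' : ℂ} (h : 0 ≤ z.im) (h' : z'.im < 0) :
    ∃ x ∈ segment ℝ z z', x.im = 0 := by
  have hpos : 0 < z.im - z'.im := by linarith
  refine ⟨_, ⟨-z'.im / (z.im - z'.im), z.im / (z.im - z'.im), by
    apply div_nonneg <;> linarith, by positivity, by field_simp; ring, rfl⟩, ?_⟩
  simp only [Complex.add_im, Complex.smul_im, smul_eq_mul]
  field_simp
  ring

namespace DoubledPolygon

variable {n : ℕ} {p : Polygon ℂ n}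

theorem sideForm_add_mul {j : Fin n} {d : ℂ} {L : ℝ} (hd : ‖d‖ = 1)
    (hj : p (finRotate n j) - p j = L * d) (q z : ℂ) :
    sideForm p j (q + z * d) = sideForm p j q + L * z.im := by
  have h1 : d * starRingEnd ℂ d = 1 := by
    rw [Complex.mul_conj, Complex.normSq_eq_norm_sq, hd]; simp
  have : (q + z * d - p j) * starRingEnd ℂ (p (finRotate n j) - p j) =
      (q - p j) * starRingEnd ℂ (p (finRotate n j) - p j) + L * z := by
    rw [hj, map_mul, Complex.conj_ofReal]
    linear_combination (L * z : ℂ) * h1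
  rw [sideForm, this, Complex.add_im, Complex.im_ofReal_mul]
  rfl

variable [NeZero n]

theorem le_dist_facePoint {C : ℝ} {x y : ℂ} (hx : x ∈ polygonRegion p) (hy : y ∈ polygonRegion p)
    (h : ∀ b ∈ p.boundary ℝ, C ≤ dist x b + dist y b) :
    C ≤ dist (facePoint p false x) (facePoint p true y) := by
  rw [facePoint_of_mem _ hx, facePoint_of_mem _ hy]
  exact le_dist_face _ _ h

theorem dist_facePoint_le {x y b : ℂ} (hx : x ∈ polygonRegion p) (hy : y ∈ polygonRegion p)
    (hb : b ∈ p.boundary ℝ) :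
    dist (facePoint p false x) (facePoint p true y) ≤ dist x b + dist y b := by
  rw [facePoint_of_mem _ hx, facePoint_of_mem _ hy]
  exact dist_face_le _ _ hb

/-- The map that unfolds the two faces along the line through `q` with direction `d`. -/
noncomputable def unfold (p : Polygon ℂ n) (q d z : ℂ) : DoubledPolygon p :=
  facePoint p (decide (z.im < 0)) (q + foldUp z * d)

theorem unfold_of_nonneg (q d : ℂ) {z : ℂ} (h : 0 ≤ z.im) :
    unfold p q d z = facePoint p false (q + z * d) := by
  simp [unfold, foldUp_of_nonneg h, not_lt.2 h]

theorem unfold_of_neg (q d : ℂ) {z : ℂ} (h : z.im < 0) :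
    unfold p q d z = facePoint p true (q + foldUp z * d) := by
  simp [unfold, h]

theorem dist_add_mul {d : ℂ} (hd : ‖d‖ = 1) (q z z' : ℂ) :
    dist (q + z * d) (q + z' * d) = dist z z' := by
  rw [dist_add_left, dist_eq_norm, ← sub_mul, norm_mul, hd, mul_one, dist_eq_norm]

/-- Near `q` each face is a half-disk, and the two are glued along the diameter. For points on
different faces, the straight segment in the unfolded disk crosses the diameter and so gives a
broken line of the right length. No broken line is shorter: through a boundary point near `q` this
is the triangle inequality after unfolding, and a boundary point far from `q` costs too much. -/
theorem IsStrictlyConvex.exists_isFlatChart_unfold (hp : IsStrictlyConvex p) (h3 : 3 ≤ n)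
    {j : Fin n} {q d : ℂ} {L : ℝ} (hd : ‖d‖ = 1) (hL : 0 < L)
    (hj : p (finRotate n j) - p j = L * d)
    (hq : q ∈ openSegment ℝ (p j) (p (finRotate n j))) :
    ∃ r, IsFlatChart (unfold p q d) r (facePoint p false q) := by
  obtain ⟨ρ, hρ, hball⟩ := hp.exists_halfDisk h3 hq
  have hSq : sideForm p j q = 0 := by
    obtain ⟨a, b, -, -, hab, rfl⟩ := hq
    rw [sideForm_combo j _ _ hab, sideForm_left, sideForm_right]; ring
  have hS : ∀ z : ℂ, sideForm p j (q + z * d) = L * z.im := fun z => by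
    rw [sideForm_add_mul hd hj, hSq, zero_add]
  have hmem : ∀ z ∈ Metric.ball (0 : ℂ) ρ, q + z * d ∈ Metric.ball q ρ := fun z hz => by
    simpa [hd] using hz
  have hreg : ∀ z ∈ Metric.ball (0 : ℂ) ρ, q + foldUp z * d ∈ polygonRegion p := fun z hz =>
    (hball _ (hmem _ (by simpa [norm_foldUp] using hz))).1 (by
      rw [hS]; exact mul_nonneg hL.le (abs_nonneg _))
  -- Half the radius: a detour through a boundary point outside the `ρ`-ball has two legs longer
  -- than `ρ / 2`, while the direct distance is less than `ρ`.
  have hsub : Metric.ball (0 : ℂ) (ρ / 2) ⊆ Metric.ball 0 ρ := Metric.ball_subset_ball (by linarith)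
  have cross : ∀ z ∈ Metric.ball (0 : ℂ) (ρ / 2), ∀ w ∈ Metric.ball (0 : ℂ) (ρ / 2),
      0 ≤ z.im → w.im < 0 → dist (unfold p q d z) (unfold p q d w) = dist z w := by
    intro z hz w hw hz0 hw0
    rw [unfold_of_nonneg q d hz0, ← foldUp_of_nonneg hz0, unfold_of_neg q d hw0,
      foldUp_of_nonneg hz0]
    have hzr : q + z * d ∈ polygonRegion p := by
      simpa [foldUp_of_nonneg hz0] using hreg z (hsub hz)
    apply le_antisymm
    · obtain ⟨x, hx, hx0⟩ := exists_im_eq_zero_mem_segment hz0 hw0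
      have hxb := (convex_ball (0 : ℂ) (ρ / 2)).segment_subset hz hw hx
      have hxbd : q + x * d ∈ p.boundary ℝ :=
        (hball _ (hmem x (hsub hxb))).2.2 (by rw [hS, hx0, mul_zero])
      refine (dist_facePoint_le hzr (hreg w (hsub hw)) hxbd).trans_eq ?_
      rw [dist_add_mul hd, dist_add_mul hd, dist_foldUp_of_im_eq_zero w hx0, dist_comm w x]
      exact dist_add_dist_of_mem_segment hx
    · refine le_dist_facePoint hzr (hreg w (hsub hw)) fun b hb => ?_
      have hd0 : d ≠ 0 := by rintro rfl; simp at hd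
      obtain ⟨x, rfl⟩ : ∃ x, b = q + x * d := ⟨(b - q) / d, by field_simp; ring⟩
      rw [dist_add_mul hd, dist_add_mul hd]
      by_cases hx : x ∈ Metric.ball (0 : ℂ) ρ
      · have h0 := (hball _ (hmem x hx)).2.1 hb
        rw [hS] at h0
        rw [dist_foldUp_of_im_eq_zero w ((mul_eq_zero.1 h0).resolve_left hL.ne')]
        exact dist_triangle_right _ _ _
      · simp only [Metric.mem_ball, dist_zero_right, not_lt] at hx hz hw
        have h1 : ‖x‖ - ‖z‖ ≤ dist z x := by
          rw [dist_comm, dist_eq_norm]; exact norm_sub_norm_le _ _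
        have h2 : ‖x‖ - ‖w‖ ≤ dist (foldUp w) x := by
          rw [dist_comm, dist_eq_norm, ← norm_foldUp w]; exact norm_sub_norm_le _ _
        have h4 : dist z w ≤ ‖z‖ + ‖w‖ := by rw [dist_eq_norm]; exact norm_sub_le _ _
        linarith
  have iso : ∀ z ∈ Metric.ball (0 : ℂ) (ρ / 2), ∀ w ∈ Metric.ball (0 : ℂ) (ρ / 2),
      dist (unfold p q d z) (unfold p q d w) = dist z w := by
    intro z hz w hw
    rcases lt_or_ge z.im 0 with hz0 | hz0 <;> rcases lt_or_ge w.im 0 with hw0 | hw0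
    · rw [unfold_of_neg q d hz0, unfold_of_neg q d hw0,
        dist_facePoint _ (hreg z (hsub hz)) (hreg w (hsub hw)), dist_add_mul hd,
        dist_foldUp_of_nonpos hz0.le hw0.le]
    · rw [dist_comm, cross w hw z hz hw0 hz0, dist_comm]
    · exact cross z hz w hw hz0 hw0
    · have h1 := hreg z (hsub hz)
      have h2 := hreg w (hsub hw)
      rw [foldUp_of_nonneg hz0] at h1
      rw [foldUp_of_nonneg hw0] at h2
      rw [unfold_of_nonneg q d hz0, unfold_of_nonneg q d hw0, dist_facePoint _ h1 h2,
        dist_add_mul hd]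
  have zero : unfold p q d 0 = facePoint p false q := by
    rw [unfold_of_nonneg q d (by simp)]; simp
  have h0 : (0 : ℂ) ∈ Metric.ball (0 : ℂ) (ρ / 2) := by simpa using hρ
  refine ⟨ρ / 2, by positivity, zero, iso, ?_⟩
  apply subset_antisymm
  · rintro _ ⟨z, hz, rfl⟩
    rw [Metric.mem_ball, ← zero, iso z hz 0 h0]
    exact hz
  · intro x hx
    obtain ⟨s, y, hy, rfl⟩ := exists_eq_facePoint x
    have hqb : q ∈ p.boundary ℝ := (hball q (Metric.mem_ball_self hρ)).2.2 hSq
    rw [Metric.mem_ball, facePoint_eq_of_mem_boundary false s hqb,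
      dist_facePoint _ hy (boundary_subset_region hqb)] at hx
    have hd0 : d ≠ 0 := by rintro rfl; simp at hd
    obtain ⟨z, rfl⟩ : ∃ z, y = q + z * d := ⟨(y - q) / d, by field_simp; ring⟩
    have hz : ‖z‖ < ρ / 2 := by simpa [hd] using hx
    have hz0 : 0 ≤ z.im := by
      have := hp.sideForm_nonneg j hy
      rw [hS] at this
      exact nonneg_of_mul_nonneg_right this hL
    rcases hz0.eq_or_lt with h | h
    · refine ⟨z, by simpa using hz, ?_⟩
      rw [unfold_of_nonneg q d hz0]
      refine facePoint_eq_of_mem_boundary _ _ ((hball _ (hmem z (hsub (by simpa using hz)))).2.2 ?_)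
      rw [hS, ← h, mul_zero]
    cases s
    · exact ⟨z, by simpa using hz, unfold_of_nonneg q d hz0⟩
    -- A point of the back face off the side comes from the lower half-disk.
    · refine ⟨starRingEnd ℂ z, by simpa using hz, ?_⟩
      rw [unfold_of_neg q d (by simpa using h), foldUp_of_nonpos (by simpa using hz0)]
      simp

end DoubledPolygon

/-- A curve that is straight in a flat chart is locally distance-realizing. -/
theorem IsFlatChart.exists_dist_eq {X : Type*} [MetricSpace X] {φ : ℂ → X} {r : ℝ} {x : X}
    (hφ : IsFlatChart φ r x) {γ : ℝ → X} {t δ : ℝ} {u : ℂ} (hu : ‖u‖ = 1) (hδ : 0 < δ)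
    (h : ∀ s, |s| < δ → γ (t + s) = φ (s • u)) :
    ∃ ε > 0, ∀ a b, |a - t| < ε → |b - t| < ε → dist (γ a) (γ b) = |a - b| := by
  refine ⟨min δ r, lt_min hδ hφ.pos, fun a b ha hb => ?_⟩
  have hmem : ∀ a, |a - t| < min δ r → (a - t) • u ∈ Metric.ball (0 : ℂ) r := fun a ha => by
    rw [mem_ball_zero_iff, norm_smul, hu, mul_one]
    exact ha.trans_le (min_le_right _ _)
  have ea := h (a - t) (ha.trans_le (min_le_left _ _))
  have eb := h (b - t) (hb.trans_le (min_le_left _ _))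
  rw [add_sub_cancel] at ea eb
  rw [ea, eb, hφ.isometry _ (hmem a ha) _ (hmem b hb), dist_eq_norm, ← sub_smul, norm_smul, hu,
    mul_one, Real.norm_eq_abs, sub_sub_sub_cancel_right]

/-! ### Regular polygons are strictly convex -/

namespace DoubledPolygon

variable {n : ℕ}

/-- The vertices of the regular polygon, in terms of the direction `a` from the center to the
midpoint of the side `i`. -/
theorem regularPolygon_add [NeZero n] (c w : ℂ) (i : Fin n) (m : ℕ) :
    regularPolygon n c w (i + Fin.ofNat n m) =
      c + w * Complex.exp ((Real.pi / n : ℝ) * Complex.I * (2 * (i : ℕ) + 2 * m)) := by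
  have hn : (n : ℂ) ≠ 0 := Nat.cast_ne_zero.2 (NeZero.ne n)
  have hmod : (((i : ℕ) + m : ℕ) : ℂ) = (((i + m) % n : ℕ) : ℂ) + n * (((i + m) / n : ℕ) : ℂ) := by
    exact_mod_cast (Nat.mod_add_div (i + m) n).symm
  have hv : ((i + Fin.ofNat n m : Fin n) : ℕ) = (i + m) % n := by
    rw [Fin.val_add, Fin.val_ofNat, Nat.add_mod_mod]
  change c + w * _ = _
  congr 2
  rw [hv, Complex.exp_eq_exp_iff_exists_int]
  refine ⟨-(((i + m) / n : ℕ) : ℤ), ?_⟩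
  generalize (i + m) % n = r at *
  generalize (i + m) / n = q at *
  push_cast at hmod ⊢
  field_simp
  linear_combination -hmod

theorem regularPolygon_apply [NeZero n] (c w : ℂ) (i : Fin n) :
    regularPolygon n c w i =
      c + w * Complex.exp ((Real.pi / n : ℝ) * Complex.I * (2 * (i : ℕ))) := by
  simpa using regularPolygon_add c w i 0

theorem regularPolygon_finRotate [NeZero n] (c w : ℂ) (i : Fin n) :
    regularPolygon n c w (finRotate n i) =
      c + w * Complex.exp ((Real.pi / n : ℝ) * Complex.I * (2 * (i : ℕ) + 2)) := by
  rw [finRotate_apply]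
  have := regularPolygon_add c w i 1
  rw [show Fin.ofNat n 1 = 1 from rfl] at this
  simpa using this

theorem finRotate_add_ofNat [NeZero n] (i : Fin n) (m : ℕ) :
    finRotate n (i + Fin.ofNat n m) = i + Fin.ofNat n (m + 1) := by
  rw [finRotate_apply, add_assoc]
  congr 1
  ext
  simp [Fin.val_add]

theorem cos_lt_cos_of_abs {θ x : ℝ} (h0 : 0 ≤ θ) (h1 : θ < |x|) (h2 : |x| < 2 * Real.pi - θ) :
    Real.cos x < Real.cos θ := by
  rw [← Real.cos_abs x]
  rcases le_total |x| Real.pi with h | h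
  · exact Real.cos_lt_cos_of_nonneg_of_le_pi h0 h h1
  · rw [← Real.cos_two_pi_sub |x|]
    exact Real.cos_lt_cos_of_nonneg_of_le_pi h0 (by linarith) (by linarith)

/-- Up to a positive factor, the form of side `k` at vertex `l` is the apothem minus the projection
of the vertex onto the outer normal of the side, that is `cos θ - cos (θ * (2l - 2k - 1))`. -/
theorem isStrictlyConvex_regularPolygon [NeZero n] (h3 : 3 ≤ n) (c : ℂ) {w : ℂ} (hw : w ≠ 0) :
    IsStrictlyConvex (regularPolygon n c w) := by
  intro k l hlk hlk'
  have hn : (0 : ℝ) < n := by positivity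
  have hpi := Real.pi_pos
  set θ : ℝ := Real.pi / n with hθ
  have hθn : θ * n = Real.pi := by rw [hθ]; field_simp
  have hθ0 : 0 < θ := by positivity
  have key : sideForm (regularPolygon n c w) k (regularPolygon n c w l) =
      Complex.normSq w *
        (2 * Real.sin θ * (Real.cos θ - Real.cos (θ * (2 * (l : ℝ) - 2 * k - 1)))) := by
    rw [sideForm, regularPolygon_apply, regularPolygon_apply, regularPolygon_finRotate, ← hθ]
    have e : ∀ x : ℝ, Complex.exp (θ * Complex.I * x) =
        Real.cos (θ * x) + Real.sin (θ * x) * Complex.I := fun x => by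
      rw [Complex.ofReal_cos, Complex.ofReal_sin, ← Complex.exp_mul_I]; push_cast; ring_nf
    have e1 := e (2 * l)
    have e2 := e (2 * k)
    have e3 := e (2 * k + 2)
    push_cast at e1 e2 e3
    rw [e1, e2, e3]
    have h1 : Real.cos (θ * (2 * (l : ℝ) - 2 * k - 1)) =
        Real.cos (θ * (2 * l)) * Real.cos (θ * (2 * k) + θ) +
          Real.sin (θ * (2 * l)) * Real.sin (θ * (2 * k) + θ) := by
      rw [← Real.cos_sub]; ring_nf
    have h2 : θ * (2 * (k : ℝ) + 2) = θ * (2 * k) + θ + θ := by ring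
    rw [h1]
    simp only [← Complex.ofReal_ofNat, ← Complex.ofReal_natCast, ← Complex.ofReal_mul,
      ← Complex.ofReal_add, ← Complex.ofReal_cos, ← Complex.ofReal_sin, h2, map_mul, map_add,
      map_sub, Complex.conj_ofReal]
    have e4 := Real.sin_sq_add_cos_sq (θ * (2 * (k : ℝ)))
    have e5 := Real.sin_sq_add_cos_sq θ
    simp only [Real.cos_add, Real.sin_add]
    generalize Real.cos (θ * (2 * (k : ℝ))) = ck at *
    generalize Real.sin (θ * (2 * (k : ℝ))) = sk at *
    generalize Real.cos (θ * (2 * (l : ℝ))) = cl at *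
    generalize Real.sin (θ * (2 * (l : ℝ))) = sl at *
    generalize Real.cos θ = ct at *
    generalize Real.sin θ = st at *
    simp only [Complex.normSq_apply, Complex.mul_im, Complex.mul_re, Complex.sub_re, Complex.sub_im,
      Complex.add_re, Complex.add_im, Complex.conj_re, Complex.conj_im, Complex.ofReal_re, Complex.ofReal_im,
      Complex.I_re, Complex.I_im]
    linear_combination (w.re * w.re + w.im * w.im) * ((sl * ck - cl * sk) * e5 + 2 * ct * st * e4)
  rw [key]
  have hsin : 0 < Real.sin θ := by
    apply Real.sin_pos_of_pos_of_lt_pi hθ0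
    rw [← hθn]
    have : (3 : ℝ) ≤ n := by exact_mod_cast h3
    nlinarith
  have hcos : Real.cos (θ * (2 * (l : ℝ) - 2 * k - 1)) < Real.cos θ := by
    -- The excluded values `±1` and `±(2n - 1)` of this odd integer belong to the two ends of side
    -- `k`, with or without wrap-around.
    have hint : 1 < |2 * (l : ℤ) - 2 * (k : ℤ) - 1| ∧
        |2 * (l : ℤ) - 2 * (k : ℤ) - 1| < 2 * n - 1 := by
      have hl := l.2
      have hk := k.2
      rw [Ne, Fin.ext_iff] at hlk hlk'
      rw [finRotate_apply, Fin.val_add, Fin.val_one', Nat.mod_eq_of_lt (a := 1) (by omega)] at hlk'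
      rcases Nat.lt_or_ge (k + 1) n with h | h
      · rw [Nat.mod_eq_of_lt h] at hlk'
        rw [lt_abs, abs_lt]; omega
      · rw [show (k : ℕ) + 1 = n by omega, Nat.mod_self] at hlk'
        rw [lt_abs, abs_lt]; omega
    have hr1 : (1 : ℝ) < |2 * (l : ℝ) - 2 * k - 1| := by exact_mod_cast hint.1
    have hr2 : |2 * (l : ℝ) - 2 * k - 1| < 2 * n - 1 := by exact_mod_cast hint.2
    apply cos_lt_cos_of_abs hθ0.le
    · rw [abs_mul, abs_of_pos hθ0]; nlinarith
    · rw [abs_mul, abs_of_pos hθ0, ← hθn]; nlinarith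
  have := Complex.normSq_pos.2 hw
  have : 0 < Real.cos θ - Real.cos (θ * (2 * (l : ℝ) - 2 * k - 1)) := by linarith
  positivity

end DoubledPolygon

/-! ### Mirror pairs and the closed curve they define -/

/-- Two unit directions at the midpoint of the side `i`, mirror images of each other in the
perpendicular bisector of that side, in which one hits other sides perpendicularly, at interior
points at the same distance `h`. -/
structure MirrorPair {n : ℕ} (p : Polygon ℂ n) (i : Fin n) where
  h : ℝ
  /-- direction and length of the side `i` -/
  dir : ℂ
  sideLen : ℝ
  /-- the two directions relative to `dir` -/
  slope : Bool → ℂ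
  /-- the sides that are hit, and their lengths -/
  side : Bool → Fin n
  farLen : Bool → ℝ
  h_pos : 0 < h
  norm_dir : ‖dir‖ = 1
  sideLen_pos : 0 < sideLen
  side_eq : p (finRotate n i) - p i = sideLen * dir
  norm_slope : ∀ b, ‖slope b‖ = 1
  slope_im_pos : ∀ b, 0 < (slope b).im
  slope_re_ne : ∀ b, (slope b).re ≠ 0
  -- `z ↦ -conj z` is the reflection in the imaginary axis, here the perpendicular bisector of the
  -- side.
  slope_not : ∀ b, slope (!b) = -starRingEnd ℂ (slope b)
  side_ne : ∀ b, i ≠ side b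
  foot_mem : ∀ b, midpoint ℝ (p i) (p (finRotate n i)) + h * (slope b * dir) ∈
    openSegment ℝ (p (side b)) (p (finRotate n (side b)))
  farLen_pos : ∀ b, 0 < farLen b
  -- The factor `I` encodes both perpendicularity and orientation: the polygon lies to the left of
  -- the far side, on the side from which the ray comes.
  farSide_eq : ∀ b, p (finRotate n (side b)) - p (side b) =
    farLen b * (Complex.I * (slope b * dir))

namespace MirrorPair

open DoubledPolygon

variable {n : ℕ} {p : Polygon ℂ n} {i : Fin n} (B : MirrorPair p i)

theorem midpoint_mem_openSegment (x y : ℂ) : midpoint ℝ x y ∈ openSegment ℝ x y :=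
  ⟨1 / 2, 1 / 2, by norm_num, by norm_num, by norm_num, by
    rw [midpoint_eq_smul_add, smul_add]; norm_num⟩

/-- The point at distance `ρ` from the midpoint in the direction `b`. -/
noncomputable def point (b : Bool) (ρ : ℝ) : ℂ :=
  midpoint ℝ (p i) (p (finRotate n i)) + ρ * (B.slope b * B.dir)

theorem point_zero (b : Bool) : B.point b 0 = midpoint ℝ (p i) (p (finRotate n i)) := by
  simp [point]

theorem point_zero_mem (b : Bool) :
    B.point b 0 ∈ openSegment ℝ (p i) (p (finRotate n i)) := by
  rw [point_zero]; exact midpoint_mem_openSegment _ _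

theorem openSegment_subset_boundary (k : Fin n) :
    openSegment ℝ (p k) (p (finRotate n k)) ⊆ p.boundary ℝ := fun _ hz =>
  mem_iUnion.2 ⟨k, by
    rw [Polygon.edgeSet, affineSegment_eq_segment]; exact openSegment_subset_segment _ _ _ hz⟩

theorem point_zero_mem_boundary (b : Bool) : B.point b 0 ∈ p.boundary ℝ :=
  openSegment_subset_boundary _ (B.point_zero_mem b)

theorem point_h_mem_boundary (b : Bool) : B.point b B.h ∈ p.boundary ℝ :=
  openSegment_subset_boundary _ (B.foot_mem b)

theorem point_mem_region (b : Bool) {ρ : ℝ} (h0 : 0 ≤ ρ) (h1 : ρ ≤ B.h) :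
    B.point b ρ ∈ polygonRegion p := by
  have hh := B.h_pos
  refine (convex_convexHull ℝ _).segment_subset
    (boundary_subset_region (B.point_zero_mem_boundary b))
    (boundary_subset_region (B.point_h_mem_boundary b))
    ⟨1 - ρ / B.h, ρ / B.h, ?_, by positivity, by ring, ?_⟩
  · rw [sub_nonneg, div_le_one hh]; exact h1
  · simp only [point, Complex.real_smul]
    have : (B.h : ℂ) ≠ 0 := by exact_mod_cast hh.ne'
    push_cast
    field_simp
    ring

theorem point_not_mem_boundary (hp : IsStrictlyConvex p) (h3 : 3 ≤ n) (b : Bool) {ρ : ℝ}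
    (h0 : 0 < ρ) (h1 : ρ < B.h) : B.point b ρ ∉ p.boundary ℝ := by
  have hh := B.h_pos
  refine hp.not_mem_boundary_of_mem_openSegment h3 (B.side_ne b) (B.point_zero_mem b)
    (B.foot_mem b) ⟨1 - ρ / B.h, ρ / B.h, ?_, by positivity, by ring, ?_⟩
  · rw [sub_pos, div_lt_one hh]; exact h1
  · simp only [point, Complex.real_smul]
    have : (B.h : ℂ) ≠ 0 := by exact_mod_cast hh.ne'
    push_cast
    field_simp
    ring

theorem norm_slope_mul_dir (b : Bool) : ‖B.slope b * B.dir‖ = 1 := by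
  rw [norm_mul, B.norm_slope, B.norm_dir, mul_one]

theorem dist_point (b : Bool) (ρ ρ' : ℝ) : dist (B.point b ρ) (B.point b ρ') = |ρ - ρ'| := by
  rw [point, point, dist_add_left, dist_eq_norm, ← sub_mul, norm_mul, norm_slope_mul_dir, mul_one,
    ← Complex.ofReal_sub, Complex.norm_real, Real.norm_eq_abs]

theorem slope_ne (b : Bool) : B.slope (!b) ≠ B.slope b := by
  intro h
  have := congrArg Complex.re h
  rw [B.slope_not] at this
  simp only [Complex.neg_re, Complex.conj_re] at this
  exact B.slope_re_ne b (by linarith)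

theorem point_injective {b b' : Bool} {ρ ρ' : ℝ} (h0 : 0 ≤ ρ) (h0' : 0 ≤ ρ')
    (h : B.point b ρ = B.point b' ρ') : ρ = ρ' ∧ (b = b' ∨ ρ = 0) := by
  have h1 : (ρ : ℂ) * (B.slope b * B.dir) = ρ' * (B.slope b' * B.dir) := add_left_cancel h
  have h2 : ρ = ρ' := by
    have := congrArg norm h1
    rwa [norm_mul (ρ : ℂ), norm_mul (ρ' : ℂ), norm_slope_mul_dir, norm_slope_mul_dir, Complex.norm_real,
      Complex.norm_real, mul_one, mul_one, Real.norm_of_nonneg h0, Real.norm_of_nonneg h0'] at this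
  refine ⟨h2, ?_⟩
  subst h2
  by_contra! hc
  obtain rfl : b' = !b := by cases b <;> cases b' <;> simp_all
  have hd : B.dir ≠ 0 := fun hd => by simpa [hd] using B.norm_dir
  exact B.slope_ne b (mul_right_cancel₀ hd
    (mul_left_cancel₀ (Complex.ofReal_ne_zero.2 hc.2) h1)).symm

/-- The curve is at the midpoint at the times `2 * h * m`; `ρ` is the distance to the nearest of
them. -/
theorem exists_time (t : ℝ) :
    ∃ (m : ℤ) (ρ : ℝ), 0 ≤ ρ ∧ ρ ≤ B.h ∧ (t = 2 * B.h * m + ρ ∨ t = 2 * B.h * m - ρ) := by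
  have hh := B.h_pos
  have hr := abs_sub_round (t / (2 * B.h))
  set m := round (t / (2 * B.h))
  have h1 : |t - 2 * B.h * m| ≤ B.h := by
    have : t - 2 * B.h * m = 2 * B.h * (t / (2 * B.h) - m) := by field_simp
    rw [this, abs_mul, abs_of_pos (by linarith)]
    nlinarith
  refine ⟨m, |t - 2 * B.h * m|, abs_nonneg _, h1, ?_⟩
  rcases abs_choice (t - 2 * B.h * m) with h | h <;> rw [h]
  · left; ring
  · right; ring

variable [NeZero n]

/-- The point of the face `s` over `B.point b ρ`. -/
noncomputable def arc (b s : Bool) (ρ : ℝ) : DoubledPolygon p := facePoint p s (B.point b ρ)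

theorem arc_zero (b b' s s' : Bool) : B.arc b s 0 = B.arc b' s' 0 := by
  rw [arc, arc, facePoint_eq_of_mem_boundary s s' (B.point_zero_mem_boundary b), point_zero,
    point_zero]

theorem arc_h (b s s' : Bool) : B.arc b s B.h = B.arc b s' B.h :=
  facePoint_eq_of_mem_boundary s s' (B.point_h_mem_boundary b)

theorem dist_arc (b s : Bool) {ρ ρ' : ℝ} (h0 : 0 ≤ ρ) (h1 : ρ ≤ B.h) (h0' : 0 ≤ ρ')
    (h1' : ρ' ≤ B.h) : dist (B.arc b s ρ) (B.arc b s ρ') = |ρ - ρ'| := by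
  rw [arc, arc, dist_facePoint _ (B.point_mem_region b h0 h1) (B.point_mem_region b h0' h1'),
    dist_point]

theorem arc_injective (hp : IsStrictlyConvex p) (h3 : 3 ≤ n) {b b' s s' : Bool} {ρ ρ' : ℝ}
    (h0 : 0 ≤ ρ) (h1 : ρ ≤ B.h) (h0' : 0 ≤ ρ') (h1' : ρ' ≤ B.h)
    (h : B.arc b s ρ = B.arc b' s' ρ') :
    ρ = ρ' ∧ (b = b' ∨ ρ = 0) ∧ (s = s' ∨ ρ = 0 ∨ ρ = B.h) := by
  obtain ⟨he, hs⟩ := facePoint_eq_imp (B.point_mem_region b h0 h1) (B.point_mem_region b' h0' h1') h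
  refine ⟨(B.point_injective h0 h0' he).1, (B.point_injective h0 h0' he).2, ?_⟩
  refine hs.imp_right fun hb => ?_
  by_contra! hc
  exact B.point_not_mem_boundary hp h3 b (h0.lt_of_ne' hc.1) (h1.lt_of_ne hc.2) hb

theorem arc_ne_conePoint (hp : IsStrictlyConvex p) (h3 : 3 ≤ n) (b s : Bool) {ρ : ℝ}
    (h0 : 0 ≤ ρ) (h1 : ρ ≤ B.h) (k : Fin n) : B.arc b s ρ ≠ conePoint k := by
  intro h
  have hv := vertex_mem_polygonRegion p k
  have he := (facePoint_eq_imp (t := false) (B.point_mem_region b h0 h1) hv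
    (h.trans (facePoint_of_mem false hv).symm)).1
  rcases h0.eq_or_lt with rfl | h0
  · exact hp.ne_vertex_of_mem_openSegment h3 (B.point_zero_mem b) k he
  rcases h1.eq_or_lt with rfl | h1
  · exact hp.ne_vertex_of_mem_openSegment h3 (B.foot_mem b) k he
  refine B.point_not_mem_boundary hp h3 b h0 h1 (he ▸ mem_iUnion.2 ⟨k, ?_⟩)
  exact left_mem_affineSegment ℝ _ _

/-- The direction of the `m`-th loop. -/
def loopDir (m : ℤ) : Bool := decide (m % 2 = 1)

theorem loopDir_add_one (m : ℤ) : loopDir (m + 1) = !loopDir m := by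
  rcases Int.emod_two_eq_zero_or_one m with h | h <;> simp [loopDir, Int.add_emod, h]

theorem loopDir_sub_one (m : ℤ) : loopDir (m - 1) = !loopDir m := by
  have := loopDir_add_one (m - 1)
  rw [sub_add_cancel] at this
  rw [this, Bool.not_not]

/-- The curve that runs back and forth along the two directions in turn: out on the front face,
back on the back face. -/
noncomputable def curve (t : ℝ) : DoubledPolygon p :=
  let m := round (t / (2 * B.h))
  if 2 * B.h * m ≤ t then B.arc (loopDir m) false (t - 2 * B.h * m)
  else B.arc (loopDir (m - 1)) true (2 * B.h * m - t)

theorem curve_sub (m : ℤ) {ρ : ℝ} (h0 : 0 ≤ ρ) (h1 : ρ ≤ B.h) :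
    B.curve (2 * B.h * m - ρ) = B.arc (loopDir (m - 1)) true ρ := by
  have hh := B.h_pos
  have hr : round ((2 * B.h * m - ρ) / (2 * B.h)) = m := by
    rw [round_eq, Int.floor_eq_iff]
    have : (2 * B.h * m - ρ) / (2 * B.h) + 1 / 2 = m + (B.h - ρ) / (2 * B.h) := by
      field_simp; ring
    rw [this]
    refine ⟨le_add_of_nonneg_right (div_nonneg (by linarith) (by linarith)), ?_⟩
    rw [add_lt_add_iff_left, div_lt_one (by linarith)]
    linarith
  -- For `ρ = 0` the definition takes its other branch, with another direction and face; this is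
  -- harmless because all arcs start at the same point.
  rcases h0.eq_or_lt with rfl | h0
  · simp only [curve, hr]
    rw [if_pos (by linarith), sub_zero, sub_self]
    exact B.arc_zero _ _ _ _
  · simp only [curve, hr]
    rw [if_neg (by linarith), sub_sub_cancel]

theorem curve_add (m : ℤ) {ρ : ℝ} (h0 : 0 ≤ ρ) (h1 : ρ ≤ B.h) :
    B.curve (2 * B.h * m + ρ) = B.arc (loopDir m) false ρ := by
  have hh := B.h_pos
  -- Since `round` rounds halves up, the time of the far side `ρ = h` is counted with the next
  -- return, where the two faces agree.
  rcases h1.eq_or_lt with rfl | h1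
  · rw [show 2 * B.h * m + B.h = 2 * B.h * (m + 1 : ℤ) - B.h by push_cast; ring,
      B.curve_sub _ hh.le le_rfl, add_sub_cancel_right]
    exact B.arc_h _ _ _
  have hr : round ((2 * B.h * m + ρ) / (2 * B.h)) = m := by
    rw [round_eq, Int.floor_eq_iff]
    have : (2 * B.h * m + ρ) / (2 * B.h) + 1 / 2 = m + (B.h + ρ) / (2 * B.h) := by
      field_simp; ring
    rw [this]
    refine ⟨le_add_of_nonneg_right (div_nonneg (by linarith) (by linarith)), ?_⟩
    rw [add_lt_add_iff_left, div_lt_one (by linarith)]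
    linarith
  simp only [curve, hr]
  rw [if_pos (by linarith), add_sub_cancel_left]

theorem exists_curve_eq_arc (t : ℝ) :
    ∃ (b s : Bool) (ρ : ℝ), 0 ≤ ρ ∧ ρ ≤ B.h ∧ B.curve t = B.arc b s ρ ∧
      B.curve (2 * B.h + t) = B.arc (!b) s ρ := by
  obtain ⟨m, ρ, h0, h1, rfl | rfl⟩ := B.exists_time t
  · refine ⟨_, _, _, h0, h1, B.curve_add m h0 h1, ?_⟩
    rw [← loopDir_add_one, ← B.curve_add _ h0 h1]
    congr 1; push_cast; ring
  · refine ⟨_, _, _, h0, h1, B.curve_sub m h0 h1, ?_⟩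
    rw [← loopDir_add_one, sub_add_cancel, ← add_sub_cancel_right m 1, ← B.curve_sub _ h0 h1]
    congr 1; push_cast; ring

theorem curve_periodic : Function.Periodic B.curve (2 * (2 * B.h)) := by
  intro t
  obtain ⟨m, ρ, h0, h1, rfl | rfl⟩ := B.exists_time t
  · rw [show 2 * B.h * m + ρ + 2 * (2 * B.h) = 2 * B.h * (m + 1 + 1 : ℤ) + ρ by push_cast; ring,
      B.curve_add _ h0 h1, B.curve_add _ h0 h1, loopDir_add_one, loopDir_add_one, Bool.not_not]
  · rw [show 2 * B.h * m - ρ + 2 * (2 * B.h) = 2 * B.h * (m + 1 + 1 : ℤ) - ρ by push_cast; ring,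
      B.curve_sub _ h0 h1, B.curve_sub _ h0 h1, loopDir_sub_one, loopDir_sub_one, loopDir_add_one,
      loopDir_add_one, Bool.not_not]

/-- The four quarters of the closed curve. -/
theorem curve_quarters {t : ℝ} (ht : t ∈ Ico 0 (2 * (2 * B.h))) :
    ∃ ρ, 0 ≤ ρ ∧ ρ ≤ B.h ∧
      ((t = ρ ∧ ρ < B.h ∧ B.curve t = B.arc false false ρ) ∨
       (t = 2 * B.h - ρ ∧ 0 < ρ ∧ B.curve t = B.arc false true ρ) ∨
       (t = 2 * B.h + ρ ∧ ρ < B.h ∧ B.curve t = B.arc true false ρ) ∨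
       (t = 4 * B.h - ρ ∧ 0 < ρ ∧ B.curve t = B.arc true true ρ)) := by
  obtain ⟨h0, h1⟩ := ht
  rcases lt_or_ge t B.h with h | h
  · refine ⟨t, h0, h.le, Or.inl ⟨rfl, h, ?_⟩⟩
    have e := B.curve_add 0 h0 h.le
    rwa [Int.cast_zero, mul_zero, zero_add] at e
  rcases lt_or_ge t (2 * B.h) with h2 | h2
  · have e1 : 0 < 2 * B.h - t := by linarith
    have e2 : 2 * B.h - t ≤ B.h := by linarith
    refine ⟨2 * B.h - t, e1.le, e2, Or.inr (Or.inl ⟨by ring, e1, ?_⟩)⟩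
    have e := B.curve_sub 1 e1.le e2
    rwa [Int.cast_one, mul_one, sub_sub_cancel] at e
  rcases lt_or_ge t (3 * B.h) with h4 | h4
  · have e1 : 0 ≤ t - 2 * B.h := by linarith
    have e2 : t - 2 * B.h < B.h := by linarith
    refine ⟨t - 2 * B.h, e1, e2.le, Or.inr (Or.inr (Or.inl ⟨by ring, e2, ?_⟩))⟩
    have e := B.curve_add 1 e1 e2.le
    rwa [Int.cast_one, mul_one, add_sub_cancel] at e
  · have e1 : 0 < 4 * B.h - t := by linarith
    have e2 : 4 * B.h - t ≤ B.h := by linarith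
    refine ⟨4 * B.h - t, e1.le, e2, Or.inr (Or.inr (Or.inr ⟨by ring, e1, ?_⟩))⟩
    have e := B.curve_sub 2 e1.le e2
    rwa [show 2 * B.h * (2 : ℤ) - (4 * B.h - t) = t by push_cast; ring] at e

theorem curve_zero : B.curve 0 = sideMidpoint i := by
  have := B.curve_add 0 le_rfl B.h_pos.le
  rw [Int.cast_zero, mul_zero, add_zero] at this
  rw [this, arc, point_zero]
  exact facePoint_of_mem _ _

theorem curve_two_h : B.curve (2 * B.h) = B.curve 0 := by
  have h1 := B.curve_add 0 le_rfl B.h_pos.le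
  have h2 := B.curve_add 1 le_rfl B.h_pos.le
  rw [Int.cast_zero, mul_zero, add_zero] at h1
  rw [Int.cast_one, mul_one, add_zero] at h2
  rw [h1, h2]
  exact B.arc_zero _ _ _ _

theorem curve_eq_curve_iff (hp : IsStrictlyConvex p) (h3 : 3 ≤ n) {s t : ℝ}
    (hs : s ∈ Ico 0 (2 * (2 * B.h))) (ht : t ∈ Ico 0 (2 * (2 * B.h))) (hst : s < t) :
    B.curve s = B.curve t ↔ s = 0 ∧ t = 2 * B.h := by
  constructor
  · intro h
    have hh := B.h_pos
    -- Of the sixteen pairs of quarters, only the first with the third survives, at `ρ = 0`. The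
    -- strict bounds in `curve_quarters` exclude the shared endpoints of the others.
    obtain ⟨ρ, a0, a1, ⟨rfl, a2, e⟩ | ⟨rfl, a2, e⟩ | ⟨rfl, a2, e⟩ | ⟨rfl, a2, e⟩⟩ :=
        B.curve_quarters hs <;>
      obtain ⟨σ, b0, b1, ⟨rfl, b2, e'⟩ | ⟨rfl, b2, e'⟩ | ⟨rfl, b2, e'⟩ | ⟨rfl, b2, e'⟩⟩ :=
        B.curve_quarters ht <;>
      rw [e, e'] at h <;>
      obtain ⟨h1, h2, h4⟩ := B.arc_injective hp h3 a0 a1 b0 b1 h <;>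
      simp only [Bool.false_eq_true, Bool.true_eq_false, true_or, false_or] at h2 h4 <;>
      first
      | (exfalso; linarith)
      | (constructor <;> linarith)
      | (exfalso; rcases h4 with h4 | h4 <;> linarith)
  · rintro ⟨rfl, rfl⟩
    exact B.curve_two_h.symm

theorem curve_ne_conePoint (hp : IsStrictlyConvex p) (h3 : 3 ≤ n) (t : ℝ) (k : Fin n) :
    B.curve t ≠ conePoint k := by
  obtain ⟨b, s, ρ, h0, h1, h, -⟩ := B.exists_curve_eq_arc t
  rw [h]
  exact B.arc_ne_conePoint hp h3 b s h0 h1 k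

end MirrorPair

/-! ### The curve is a geodesic and its halves form a net -/

namespace MirrorPair

open DoubledPolygon

variable {n : ℕ} {p : Polygon ℂ n} {i : Fin n} (B : MirrorPair p i)

theorem point_add_smul (b : Bool) (ρ s : ℝ) :
    B.point b ρ + s • (B.slope b * B.dir) = B.point b (ρ + s) := by
  simp only [point, Complex.real_smul]
  push_cast
  ring

variable [NeZero n]

theorem unfold_midpoint (b : Bool) {s : ℝ} (hs : 0 ≤ s) :
    unfold p (B.point b 0) B.dir (s • B.slope b) = B.arc b false s := by
  rw [unfold_of_nonneg _ _ (by simpa using mul_nonneg hs (B.slope_im_pos b).le), arc, point_zero,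
    point, Complex.real_smul, mul_assoc]

theorem unfold_midpoint_conj (b : Bool) {s : ℝ} (hs : 0 ≤ s) :
    unfold p (B.point b 0) B.dir (s • starRingEnd ℂ (B.slope b)) = B.arc b true s := by
  rcases hs.eq_or_lt with rfl | hs
  · rw [zero_smul, B.arc_zero b b true false, ← B.unfold_midpoint b le_rfl, zero_smul]
  have him : (s • starRingEnd ℂ (B.slope b)).im < 0 := by
    simpa using mul_pos hs (B.slope_im_pos b)
  rw [unfold_of_neg _ _ him, foldUp_of_nonpos him.le, arc, point_zero, point, Complex.real_smul,
    map_mul, Complex.conj_conj, Complex.conj_ofReal, mul_assoc]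

/-- In the chart at the foot the polygon is the upper half-plane, so a perpendicular hit is motion
in the direction `-I`; `s ≤ 0` is the time before the hit. -/
theorem unfold_foot (b : Bool) {s : ℝ} (hs : s ≤ 0) :
    unfold p (B.point b B.h) (Complex.I * (B.slope b * B.dir)) (s • -Complex.I) =
      B.arc b false (B.h + s) := by
  rw [unfold_of_nonneg _ _ (by simpa using hs), arc, ← point_add_smul, Complex.real_smul,
    Complex.real_smul]
  congr 2
  linear_combination (-s * (B.slope b * B.dir)) * Complex.I_mul_I

theorem unfold_foot_conj (b : Bool) {s : ℝ} (hs : 0 ≤ s) :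
    unfold p (B.point b B.h) (Complex.I * (B.slope b * B.dir)) (s • -Complex.I) =
      B.arc b true (B.h - s) := by
  rcases hs.eq_or_lt with rfl | hs
  · rw [B.unfold_foot b le_rfl, add_zero, sub_zero]
    exact B.arc_h b _ _
  have him : (s • -Complex.I).im < 0 := by simpa using hs
  rw [unfold_of_neg _ _ him, foldUp_of_nonpos him.le, arc, sub_eq_add_neg, ← point_add_smul]
  simp only [Complex.real_smul, map_mul, map_neg, Complex.conj_I, Complex.conj_ofReal]
  push_cast
  congr 2
  linear_combination (s * (B.slope b * B.dir)) * Complex.I_mul_I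

theorem exists_chart_midpoint (hp : IsStrictlyConvex p) (h3 : 3 ≤ n) (b : Bool) :
    ∃ r, IsFlatChart (unfold p (B.point b 0) B.dir) r (facePoint p false (B.point b 0)) :=
  hp.exists_isFlatChart_unfold h3 B.norm_dir B.sideLen_pos B.side_eq (B.point_zero_mem b)

theorem exists_chart_foot (hp : IsStrictlyConvex p) (h3 : 3 ≤ n) (b : Bool) :
    ∃ r, IsFlatChart (unfold p (B.point b B.h) (Complex.I * (B.slope b * B.dir))) r
      (facePoint p false (B.point b B.h)) :=
  hp.exists_isFlatChart_unfold h3 (by rw [norm_mul, Complex.norm_I, one_mul, norm_slope_mul_dir])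
    (B.farLen_pos b) (B.farSide_eq b) (B.foot_mem b)

/-- The curve arrives on the back face along the previous direction, which unfolds to the ray of
`conj (slope (!b))`. By `slope_not` this is opposite to the ray of `slope b` along which it leaves.
-/
theorem curve_near_midpoint (m : ℤ) {s : ℝ} (hs : |s| < B.h) :
    B.curve (2 * B.h * m + s) =
      unfold p (B.point (loopDir m) 0) B.dir (s • B.slope (loopDir m)) := by
  obtain ⟨h1, h2⟩ := abs_lt.1 hs
  rcases le_total 0 s with h | h
  · rw [B.unfold_midpoint _ h, B.curve_add _ h h2.le]
  · have := B.unfold_midpoint_conj (!loopDir m) (neg_nonneg.2 h)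
    rw [B.slope_not, map_neg, Complex.conj_conj, neg_smul_neg, point_zero] at this
    rw [point_zero, this, ← sub_neg_eq_add, B.curve_sub _ (neg_nonneg.2 h) (by linarith),
      loopDir_sub_one]

theorem curve_near_foot (m : ℤ) {s : ℝ} (hs : |s| < B.h) :
    B.curve (2 * B.h * m + B.h + s) =
      unfold p (B.point (loopDir m) B.h) (Complex.I * (B.slope (loopDir m) * B.dir))
        (s • -Complex.I) := by
  obtain ⟨h1, h2⟩ := abs_lt.1 hs
  rcases le_total 0 s with h | h
  · rw [B.unfold_foot_conj _ h, show 2 * B.h * m + B.h + s = 2 * B.h * (m + 1 : ℤ) - (B.h - s) by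
      push_cast; ring, B.curve_sub _ (by linarith) (by linarith), add_sub_cancel_right]
  · rw [B.unfold_foot _ h, add_assoc, B.curve_add _ (by linarith) (by linarith)]

/-- At the midpoint and at a foot the curve is straight in a flat chart; at all other times it stays
for a while on one segment in one face. -/
theorem exists_dist_curve_eq (hp : IsStrictlyConvex p) (h3 : 3 ≤ n) (t : ℝ) :
    ∃ ε > 0, ∀ a b, |a - t| < ε → |b - t| < ε → dist (B.curve a) (B.curve b) = |a - b| := by
  have hmid : ∀ m : ℤ, ∃ ε > 0, ∀ a b, |a - 2 * B.h * m| < ε → |b - 2 * B.h * m| < ε →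
      dist (B.curve a) (B.curve b) = |a - b| := fun m => by
    obtain ⟨r, hr⟩ := B.exists_chart_midpoint hp h3 (loopDir m)
    exact hr.exists_dist_eq (B.norm_slope _) B.h_pos fun s hs => B.curve_near_midpoint m hs
  have hfoot : ∀ m : ℤ, ∃ ε > 0, ∀ a b, |a - (2 * B.h * m + B.h)| < ε →
      |b - (2 * B.h * m + B.h)| < ε → dist (B.curve a) (B.curve b) = |a - b| := fun m => by
    obtain ⟨r, hr⟩ := B.exists_chart_foot hp h3 (loopDir m)
    exact hr.exists_dist_eq (by simp) B.h_pos fun s hs => B.curve_near_foot m hs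
  obtain ⟨m, ρ, h0, h1, ht⟩ := B.exists_time t
  rcases h0.eq_or_lt with rfl | h0
  · obtain rfl : t = 2 * B.h * m := by rcases ht with h | h <;> linarith
    exact hmid m
  rcases h1.eq_or_lt with rfl | h1
  · rcases ht with rfl | rfl
    · exact hfoot m
    · have := hfoot (m - 1)
      rwa [show 2 * B.h * ((m - 1 : ℤ) : ℝ) + B.h = 2 * B.h * m - B.h by push_cast; ring] at this
  refine ⟨min ρ (B.h - ρ), lt_min h0 (by linarith), fun a b ha hb => ?_⟩
  rw [lt_min_iff, abs_lt, abs_lt] at ha hb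
  obtain ⟨⟨a1, a2⟩, a3, a4⟩ := ha
  obtain ⟨⟨b1, b2⟩, b3, b4⟩ := hb
  rcases ht with rfl | rfl
  · obtain ⟨x, rfl⟩ : ∃ x, a = 2 * B.h * m + x := ⟨a - 2 * B.h * m, by ring⟩
    obtain ⟨y, rfl⟩ : ∃ y, b = 2 * B.h * m + y := ⟨b - 2 * B.h * m, by ring⟩
    rw [B.curve_add _ (by linarith) (by linarith), B.curve_add _ (by linarith) (by linarith),
      B.dist_arc _ _ (by linarith) (by linarith) (by linarith) (by linarith),
      add_sub_add_left_eq_sub]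
  · obtain ⟨x, rfl⟩ : ∃ x, a = 2 * B.h * m - x := ⟨2 * B.h * m - a, by ring⟩
    obtain ⟨y, rfl⟩ : ∃ y, b = 2 * B.h * m - y := ⟨2 * B.h * m - b, by ring⟩
    rw [B.curve_sub _ (by linarith) (by linarith), B.curve_sub _ (by linarith) (by linarith),
      B.dist_arc _ _ (by linarith) (by linarith) (by linarith) (by linarith),
      sub_sub_sub_cancel_left, abs_sub_comm]

theorem isClosedGeodesic_curve (hp : IsStrictlyConvex p) (h3 : 3 ≤ n) :
    IsClosedGeodesic B.curve (2 * (2 * B.h)) := by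
  refine ⟨by linarith [B.h_pos], B.curve_periodic, fun t _ => ?_⟩
  obtain ⟨ε, hε, h⟩ := B.exists_dist_curve_eq hp h3 t
  exact ⟨ε, hε, fun a _ b _ => h a b⟩

theorem curve_crossesPerpendicularly (m : ℤ) :
    CrossesPerpendicularly B.curve (B.side (loopDir m)) (2 * B.h * m + B.h) := by
  set b := loopDir m with hb
  have hpt : ∀ t, B.point b B.h + t • -(B.slope b * B.dir) = B.point b (B.h - t) := fun t => by
    rw [smul_neg, ← neg_smul, point_add_smul, sub_eq_add_neg]
  refine ⟨_, B.foot_mem b, -(B.slope b * B.dir), by rw [norm_neg, norm_slope_mul_dir], ?_,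
    false, B.h, B.h_pos, fun t ht => ⟨?_, ?_, ?_⟩⟩
  · rw [B.farSide_eq b, Complex.inner]
    simp only [Complex.mul_re, Complex.mul_im, map_neg, map_mul, Complex.neg_re, Complex.neg_im,
      Complex.conj_re, Complex.conj_im, Complex.I_re, Complex.I_im, Complex.ofReal_re,
      Complex.ofReal_im]
    ring
  · change B.point b B.h + _ ∈ _
    rw [hpt]
    exact B.point_mem_region b (by linarith [ht.2]) (by linarith [ht.1])
  · rw [← facePoint_of_mem]
    change _ = facePoint p _ (B.point b B.h + _)
    rw [hpt, add_sub_assoc, B.curve_add _ (by linarith [ht.2]) (by linarith [ht.1])]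
    rfl
  · rw [← facePoint_of_mem]
    change _ = facePoint p _ (B.point b B.h + _)
    rw [hpt, show 2 * B.h * m + B.h + t = 2 * B.h * (m + 1 : ℤ) - (B.h - t) by
      push_cast; ring, B.curve_sub _ (by linarith [ht.2]) (by linarith [ht.1]),
      add_sub_cancel_right]
    rfl

/-- The two ends of the first loop leave in the directions `v` and `conj v`, so at time `s` they are
`2 * s * v.im` apart. This equals `2 * s` only if `v = I`, against `slope_re_ne`. -/
theorem curve_not_joinSmoothly (hp : IsStrictlyConvex p) (h3 : 3 ≤ n) :
    ¬ JoinSmoothly B.curve (fun t => B.curve (2 * B.h - t)) := by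
  rintro ⟨ε, hε, h⟩
  obtain ⟨r, hr⟩ := B.exists_chart_midpoint hp h3 false
  have hh := B.h_pos
  obtain ⟨s, hs0, hs⟩ := exists_between (lt_min hε (lt_min hr.pos hh))
  obtain ⟨h1, h2, h4⟩ : s < ε ∧ s < r ∧ s < B.h := by simpa using hs
  have key := h s ⟨hs0.le, h1⟩ s ⟨hs0.le, h1⟩
  have e1 := B.curve_add 0 hs0.le h4.le
  have e2 := B.curve_sub 1 hs0.le h4.le
  rw [Int.cast_zero, mul_zero, zero_add] at e1
  rw [Int.cast_one, mul_one] at e2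
  change _ = B.arc false _ _ at e1
  change _ = B.arc false _ _ at e2
  have hb : ∀ z : ℂ, ‖z‖ = 1 → s • z ∈ Metric.ball (0 : ℂ) r := fun z hz => by
    rw [mem_ball_zero_iff, norm_smul, hz, mul_one, Real.norm_of_nonneg hs0.le]; exact h2
  dsimp only at key
  rw [e1, e2, ← B.unfold_midpoint _ hs0.le, ← B.unfold_midpoint_conj _ hs0.le,
    hr.isometry _ (hb _ (B.norm_slope _)) _ (hb _ (by rw [RCLike.norm_conj, B.norm_slope])),
    dist_eq_norm, ← smul_sub, norm_smul, Complex.sub_conj, norm_mul, Complex.norm_I, mul_one,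
    Complex.norm_real, Real.norm_of_nonneg hs0.le, Real.norm_of_nonneg
      (mul_nonneg zero_le_two (B.slope_im_pos false).le)] at key
  have him : (B.slope false).im = 1 := by
    have : s * (2 * (B.slope false).im) = s * 2 := by linarith
    linarith [mul_left_cancel₀ hs0.ne' this]
  have hn := B.norm_slope false
  rw [← sq_eq_sq₀ (norm_nonneg _) zero_le_one, ← Complex.normSq_eq_norm_sq, Complex.normSq_apply,
    him] at hn
  exact B.slope_re_ne false (mul_self_eq_zero.1 (by linarith))

/-- The figure-eight net whose two loops are the two halves of the curve. -/
noncomputable def net (hp : IsStrictlyConvex p) (h3 : 3 ≤ n) :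
    GeodesicNet (DoubledPolygon p) figureEight where
  pos _ := B.curve 0
  ends _ _ := ()
  len _ := 2 * B.h
  curve e t := B.curve (2 * B.h * (e : ℕ) + t)
  isLink e _ := by simp [figureEight]
  len_pos _ _ := by linarith [B.h_pos]
  curve_start e _ := by
    fin_cases e
    · simp
    · simp [B.curve_two_h]
  curve_end e _ := by
    fin_cases e
    · simp [B.curve_two_h]
    · have := B.curve_periodic 0
      simpa [two_mul] using this
  geodesic e _ t _ := by
    obtain ⟨ε, hε, h⟩ := B.exists_dist_curve_eq hp h3 (2 * B.h * (e : ℕ) + t)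
    refine ⟨ε, hε, fun a _ b _ ha hb => ?_⟩
    rw [h _ _ (by simpa using ha) (by simpa using hb), add_sub_add_left_eq_sub]
  pos_injOn := fun _ _ _ _ _ => rfl
  curve_inj e _ e' _ s hs t ht h := by
    have hh := B.h_pos
    obtain ⟨hs0, hs1⟩ := hs
    obtain ⟨ht0, ht1⟩ := ht
    have mem : ∀ (e : Fin 2) (s : ℝ), 0 < s → s < 2 * B.h →
        2 * B.h * (e : ℕ) + s ∈ Ico 0 (2 * (2 * B.h)) ∧ 2 * B.h * (e : ℕ) + s ≠ 0 := by
      intro e s h0 h1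
      fin_cases e
      · simp only [Nat.cast_zero, mul_zero, zero_add]
        exact ⟨⟨h0.le, by linarith⟩, h0.ne'⟩
      · simp only [Nat.cast_one, mul_one]
        exact ⟨⟨by linarith, by linarith⟩, by linarith⟩
    obtain ⟨ms, ns⟩ := mem e s hs0 hs1
    obtain ⟨mt, nt⟩ := mem e' t ht0 ht1
    have heq : 2 * B.h * (e : ℕ) + s = 2 * B.h * (e' : ℕ) + t := by
      rcases lt_trichotomy (2 * B.h * ((e : ℕ) : ℝ) + s) (2 * B.h * ((e' : ℕ) : ℝ) + t) with
        hlt | heq | hlt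
      · exact absurd ((B.curve_eq_curve_iff hp h3 ms mt hlt).1 h).1 ns
      · exact heq
      · exact absurd ((B.curve_eq_curve_iff hp h3 mt ms hlt).1 h.symm).1 nt
    fin_cases e <;> fin_cases e' <;> simp at heq ⊢ <;> linarith
  curve_ne_pos e _ s hs _ _ h := by
    have hh := B.h_pos
    obtain ⟨hs0, hs1⟩ := hs
    have m0 : (0 : ℝ) ∈ Ico 0 (2 * (2 * B.h)) := ⟨le_rfl, by linarith⟩
    fin_cases e
    · simp only [Nat.cast_zero, mul_zero, zero_add] at h
      have := ((B.curve_eq_curve_iff hp h3 m0 ⟨hs0.le, by linarith⟩ hs0).1 h.symm).2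
      linarith
    · simp only [Nat.cast_one, mul_one] at h
      have := ((B.curve_eq_curve_iff hp h3 m0 ⟨by linarith, by linarith⟩ (by linarith)).1 h.symm).2
      linarith
  balanced _ _ := by
    obtain ⟨r, hr⟩ := B.exists_chart_midpoint hp h3 false
    have h0 : B.curve 0 = facePoint p false (B.point false 0) := by
      have := B.curve_add 0 le_rfl B.h_pos.le
      rwa [Int.cast_zero, mul_zero, add_zero] at this
    have hc : ∀ b, B.point b 0 = B.point false 0 := fun b => by rw [point_zero, point_zero]
    -- A loop starts on the front face, in the upper half of the chart, and ends on the back face,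
    -- in the lower half; hence the conjugate at its end.
    refine ⟨_, r, fun x => if x.2 then starRingEnd ℂ (B.slope (loopDir (x.1 : ℕ)))
      else B.slope (loopDir (x.1 : ℕ)), h0 ▸ hr, fun e _ _ => ⟨?_, B.h, B.h_pos, fun t ht => ?_⟩,
      fun e _ _ => ⟨?_, B.h, B.h_pos, fun t ht => ?_⟩, ?_⟩
    · simp [B.norm_slope]
    · have := B.curve_add (e : ℕ) ht.1 ht.2
      rw [Int.cast_natCast] at this
      dsimp only
      rw [this, ← hc (loopDir (e : ℕ))]
      exact (B.unfold_midpoint _ ht.1).symm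
    · simp [B.norm_slope]
    · have := B.curve_sub ((e : ℕ) + 1) ht.1 ht.2
      rw [add_sub_cancel_right] at this
      dsimp only
      rw [show 2 * B.h * ((e : ℕ) : ℝ) + (2 * B.h - t) = 2 * B.h * (((e : ℕ) + 1 : ℤ) : ℝ) - t by
        push_cast; ring, this, ← hc (loopDir (e : ℕ))]
      exact (B.unfold_midpoint_conj _ ht.1).symm
    · have hs := B.slope_not false
      rw [Bool.not_false] at hs
      simp [Fintype.sum_prod_type, loopDir, figureEight, hs]

end MirrorPair

/-! ### The mirror pair of an odd regular polygon -/

open DoubledPolygon in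
/-- In a regular polygon with an odd number of sides, the perpendiculars from the midpoint of a side
to the two sides opposite to it. -/
theorem exists_mirrorPair_regularPolygon (n : ℕ) [NeZero n] (hn : Odd n) (h3 : 3 ≤ n) (c w : ℂ)
    (hw : w ≠ 0) (i : Fin n) :
    ∃ B : MirrorPair (regularPolygon n c w) i,
      B.side false = i + Fin.ofNat n (n / 2) ∧ B.side true = i + Fin.ofNat n (n / 2 + 1) ∧
      ∀ b ρ, axisReflection c (midpoint ℝ (regularPolygon n c w i)
          (regularPolygon n c w (finRotate n i))) (B.point b ρ) = B.point (!b) ρ := by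
  obtain ⟨m, hm⟩ := hn
  have hm2 : n / 2 = m := by omega
  have hm1 : 1 ≤ m := by omega
  rw [hm2]
  set θ : ℝ := Real.pi / n with hθ
  have hn0 : (0 : ℝ) < n := by positivity
  have hθn : θ * n = Real.pi := by rw [hθ]; field_simp
  have hθ0 : 0 < θ := div_pos Real.pi_pos hn0
  have hθ1 : θ < Real.pi / 2 := by
    have : (3 : ℝ) ≤ n := by exact_mod_cast h3
    nlinarith
  have hcos : 0 < Real.cos θ := Real.cos_pos_of_mem_Ioo ⟨by linarith, hθ1⟩
  have hsin : 0 < Real.sin θ := Real.sin_pos_of_pos_of_lt_pi hθ0 (by linarith)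
  have hcos1 : Real.cos θ < 1 := by nlinarith [Real.sin_sq_add_cos_sq θ]
  have hsc := Real.sin_sq_add_cos_sq θ
  set R : ℝ := ‖w‖
  have hR : 0 < R := norm_pos_iff.2 hw
  have hRc : (R : ℂ) ≠ 0 := by exact_mod_cast hR.ne'
  -- `f` is the unit vector from the center to the midpoint of side `i`, and `R` is the
  -- circumradius.
  set f : ℂ := w / R * Complex.exp (θ * Complex.I * (2 * (i : ℕ) + 1)) with hf
  set E : ℂ := Complex.exp (θ * Complex.I) with hE
  set E' : ℂ := Complex.exp (-(θ * Complex.I)) with hE'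
  have hEE : E * E' = 1 := by rw [hE, hE', ← Complex.exp_add, add_neg_cancel, Complex.exp_zero]
  have hEv : E = Real.cos θ + Real.sin θ * Complex.I := by
    rw [hE, Complex.exp_mul_I, Complex.ofReal_cos, Complex.ofReal_sin]
  have hEv' : E' = Real.cos θ - Real.sin θ * Complex.I := by
    rw [hE', ← neg_mul, Complex.exp_mul_I, Complex.cos_neg, Complex.sin_neg, Complex.ofReal_cos,
      Complex.ofReal_sin]
    ring
  have hf1 : ‖f‖ = 1 := by
    rw [hf, norm_mul, norm_div, Complex.norm_real, Real.norm_of_nonneg hR.le, div_self hR.ne',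
      one_mul, Complex.norm_exp]
    simp
  have v0 : regularPolygon n c w i = c + R * f * E' := by
    rw [regularPolygon_apply, hf, hE']
    have : Complex.exp (θ * Complex.I * (2 * (i : ℕ))) =
        Complex.exp (θ * Complex.I * (2 * (i : ℕ) + 1)) * Complex.exp (-(θ * Complex.I)) := by
      rw [← Complex.exp_add]; ring_nf
    rw [← hθ, this]
    field_simp
  have v1 : regularPolygon n c w (finRotate n i) = c + R * f * E := by
    rw [regularPolygon_finRotate, hf, hE]
    have : Complex.exp (θ * Complex.I * (2 * (i : ℕ) + 2)) =
        Complex.exp (θ * Complex.I * (2 * (i : ℕ) + 1)) * Complex.exp (θ * Complex.I) := by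
      rw [← Complex.exp_add]; ring_nf
    rw [← hθ, this]
    field_simp
  -- Here oddness matters: as `θ * n = π`, the `n` in `2 * l` is a half-turn. So the far vertices
  -- lie at the angles `-2θ`, `0`, `2θ` from `-f`.
  have far : ∀ (l : ℕ) (k : ℂ), (2 * l : ℂ) = n + 1 + k →
      regularPolygon n c w (i + Fin.ofNat n l) = c - R * f * Complex.exp (θ * Complex.I * k) := by
    intro l k hl
    have hpi : (θ : ℂ) * n = Real.pi := by exact_mod_cast hθn
    have : Complex.exp (θ * Complex.I * (2 * (i : ℕ) + 2 * l)) =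
        -(Complex.exp (θ * Complex.I * (2 * (i : ℕ) + 1)) * Complex.exp (θ * Complex.I * k)) := by
      rw [← neg_one_mul, ← Complex.exp_pi_mul_I, ← Complex.exp_add, ← Complex.exp_add, hl, ← hpi]
      ring_nf
    rw [regularPolygon_add, ← hθ, this, hf]
    field_simp
    ring
  have hmC : (n : ℂ) = 2 * m + 1 := by exact_mod_cast hm
  have f0 : regularPolygon n c w (i + Fin.ofNat n m) = c - R * f * E' ^ 2 := by
    rw [far m (-2) (by rw [hmC]; ring), hE', ← Complex.exp_nat_mul]
    congr 3; push_cast; ring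
  have f1 : regularPolygon n c w (i + Fin.ofNat n (m + 1)) = c - R * f := by
    rw [far (m + 1) 0 (by rw [hmC]; push_cast; ring), mul_zero, Complex.exp_zero, mul_one]
  have f2 : regularPolygon n c w (i + Fin.ofNat n (m + 1 + 1)) = c - R * f * E ^ 2 := by
    rw [far (m + 1 + 1) 2 (by rw [hmC]; push_cast; ring), hE, ← Complex.exp_nat_mul]
    congr 3; push_cast; ring
  have norm_E : ‖E‖ = 1 := by rw [hE, Complex.norm_exp_ofReal_mul_I]
  -- From here on only algebraic relations between `E`, `E'`, `C = cos θ` and `S = sin θ` are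
  -- needed.
  clear_value f E E' R
  clear hE hE' hf far
  generalize Real.cos θ = C at *
  generalize Real.sin θ = S at *
  have hscC : (S : ℂ) ^ 2 + (C : ℂ) ^ 2 = 1 := by exact_mod_cast hsc
  have hE2 : E ^ 2 = 2 * C * E - 1 := by
    rw [hEv]; linear_combination (S : ℂ) ^ 2 * Complex.I_sq - hscC
  have hE2' : E' ^ 2 = 2 * C * E' - 1 := by
    rw [hEv']; linear_combination (S : ℂ) ^ 2 * Complex.I_sq - hscC
  have hEsub : E - E' = 2 * S * Complex.I := by rw [hEv, hEv']; ring
  have hconj : starRingEnd ℂ E = E' := by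
    rw [hEv, hEv', map_add, map_mul, Complex.conj_ofReal, Complex.conj_ofReal, Complex.conj_I]
    ring
  have hconj' : starRingEnd ℂ E' = E := by rw [← hconj, Complex.conj_conj]
  have hM : midpoint ℝ (regularPolygon n c w i) (regularPolygon n c w (finRotate n i)) =
      c + R * f * C := by
    rw [midpoint_eq_smul_add, v0, v1, hEv, hEv', Complex.real_smul, invOf_eq_inv]
    push_cast
    ring
  have hI := Complex.I_mul_I
  have norm_E' : ‖E'‖ = 1 := by rw [← hconj, RCLike.norm_conj, norm_E]
  have re_E : E.re = C := by rw [hEv]; simp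
  have re_E' : E'.re = C := by rw [hEv']; simp
  have im_E : E.im = S := by rw [hEv]; simp
  have im_E' : E'.im = -S := by rw [hEv']; simp
  have side_ne : ∀ l, 0 < l → l < n → i ≠ i + Fin.ofNat n l := by
    intro l h0 h1 h
    rw [Fin.ext_iff, Fin.val_add, Fin.val_ofNat, Nat.mod_eq_of_lt h1] at h
    have := i.2
    rcases Nat.lt_or_ge (i + l) n with hlt | hge
    · rw [Nat.mod_eq_of_lt hlt] at h; omega
    · rw [Nat.mod_eq_sub_mod hge, Nat.mod_eq_of_lt (by omega)] at h; omega
  refine ⟨{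
    -- The apothem `R * C` plus the projection `R * C * C` of the vector from the midpoint to the
    -- center onto the normal of the far side.
    h := R * C * (1 + C)
    dir := Complex.I * f
    sideLen := 2 * R * S
    slope := fun b => Complex.I * (if b then E else E')
    side := fun b => i + Fin.ofNat n (if b then m + 1 else m)
    farLen := fun _ => 2 * R * S
    h_pos := by positivity
    norm_dir := by rw [norm_mul, Complex.norm_I, hf1, one_mul]
    sideLen_pos := by positivity
    side_eq := by
      rw [v0, v1]
      push_cast
      linear_combination R * f * hEsub
    norm_slope := by rintro (_ | _) <;> simp [norm_E, norm_E']
    slope_im_pos := by rintro (_ | _) <;> simpa [re_E, re_E'] using hcos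
    slope_re_ne := by rintro (_ | _) <;> simpa [im_E, im_E'] using hsin.ne'
    slope_not := by rintro (_ | _) <;> simp [hconj, hconj']
    side_ne := by
      rintro (_ | _)
      · exact side_ne m hm1 (by omega)
      · exact side_ne (m + 1) (by omega) (by omega)
    foot_mem := ?_
    farLen_pos := fun _ => by positivity
    farSide_eq := ?_ }, rfl, rfl, ?_⟩
  · rintro (_ | _)
    -- The foot is `R * C * S` away from the midpoint of the far side, whose half-length is `R * S`;
    -- hence these weights, positive because `0 < C < 1`.
    · refine ⟨(1 + C) / 2, (1 - C) / 2, by linarith, by linarith, by ring, ?_⟩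
      simp only [Bool.false_eq_true, if_false]
      rw [finRotate_add_ofNat, f0, f1, hM, hE2', Complex.real_smul, Complex.real_smul]
      push_cast
      linear_combination (-(R * C * (1 + C) * E' * f) : ℂ) * hI
    · refine ⟨(1 - C) / 2, (1 + C) / 2, by linarith, by linarith, by ring, ?_⟩
      simp only [if_true]
      rw [finRotate_add_ofNat, f1, f2, hM, hE2, Complex.real_smul, Complex.real_smul]
      push_cast
      linear_combination (-(R * C * (1 + C) * E * f) : ℂ) * hI
  · rintro (_ | _)
    · simp only [Bool.false_eq_true, if_false]
      rw [finRotate_add_ofNat, f0, f1]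
      push_cast
      linear_combination (R * f : ℂ) * hEE - R * f * E' * hEsub -
        2 * R * S * Complex.I * E' * f * hI
    · simp only [if_true]
      rw [finRotate_add_ofNat, f1, f2]
      push_cast
      linear_combination (-(R * f) : ℂ) * hEE - R * f * E * hEsub -
        2 * R * S * Complex.I * E * f * hI
  · intro b ρ
    have hf0 : f ≠ 0 := fun h => by simp [h] at hf1
    have hc0 : (C : ℂ) ≠ 0 := by exact_mod_cast hcos.ne'
    -- Relative to the axis the unit vector `f` cancels, so the reflection only conjugates `X`,
    -- which swaps `E` and `E'`.
    have hd : ∀ X : ℂ, (c + R * f * C + ρ * (Complex.I * X * (Complex.I * f)) - c) /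
        (c + R * f * C - c) = (R * C - ρ * X : ℂ) / (R * C : ℂ) := by
      intro X
      rw [div_eq_div_iff (by rw [add_sub_cancel_left]; positivity) (by positivity)]
      linear_combination (ρ * X * f * R * C : ℂ) * hI
    have he : ∀ X : ℂ, c + (c + R * f * C - c) * ((R * C - ρ * X : ℂ) / (R * C : ℂ)) =
        c + R * f * C + ρ * (Complex.I * X * (Complex.I * f)) := by
      intro X
      have : R * f * C * ((R * C - ρ * X : ℂ) / (R * C : ℂ)) = f * (R * C - ρ * X) := by
        field_simp
      rw [add_sub_cancel_left, this]
      linear_combination (-(ρ * X * f) : ℂ) * hI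
    simp only [MirrorPair.point, axisReflection]
    rw [hM, hd, map_div₀, map_sub, map_mul, map_mul]
    simp only [Complex.conj_ofReal]
    rw [he]
    cases b <;> simp [hconj, hconj']

open DoubledPolygon in
theorem mainTheorem4 (n : ℕ) [NeZero n] (hn : Odd n) (h3 : 3 ≤ n) (c w : ℂ) (hw : w ≠ 0)
    (i : Fin n) :
    ∃ (N : GeodesicNet (DoubledPolygon (regularPolygon n c w)) figureEight)
      (γ : ℝ → DoubledPolygon (regularPolygon n c w)) (ℓ : ℝ),
      -- a closed geodesic of length `2ℓ` that starts at the midpoint of side `i`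
      -- and avoids the cone points
      IsClosedGeodesic γ (2 * ℓ) ∧
      γ 0 = DoubledPolygon.sideMidpoint i ∧
      (∀ (t : ℝ) (k : Fin n), γ t ≠ DoubledPolygon.conePoint k) ∧
      -- its only self-intersection is the return to that midpoint at time `ℓ`
      (∀ s ∈ Set.Ico 0 (2 * ℓ), ∀ t ∈ Set.Ico 0 (2 * ℓ), s < t →
        (γ s = γ t ↔ s = 0 ∧ t = ℓ)) ∧
      -- its two halves are the two loops of the net
      (∀ e, N.len e = ℓ) ∧
      (∀ t ∈ Set.Icc 0 ℓ, N.curve 0 t = γ t ∧ N.curve 1 t = γ (ℓ + t)) ∧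
      -- they cross the two far sides perpendicularly
      DoubledPolygon.CrossesPerpendicularly γ (i + Fin.ofNat n (n / 2)) (ℓ / 2) ∧
      DoubledPolygon.CrossesPerpendicularly γ (i + Fin.ofNat n (n / 2 + 1)) (ℓ + ℓ / 2) ∧
      -- the first half does not close up smoothly
      ¬ JoinSmoothly γ (fun t => γ (ℓ - t)) ∧
      -- the second half is the mirror image of the first one
      (∀ t : ℝ, ∃ (s : Bool) (z z' : polygonRegion (regularPolygon n c w)),
        γ t = DoubledPolygon.face s z ∧ γ (ℓ + t) = DoubledPolygon.face s z' ∧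
        (z' : ℂ) = axisReflection c (midpoint ℝ (regularPolygon n c w i)
          (regularPolygon n c w (finRotate n i))) z) := by
  have hp := isStrictlyConvex_regularPolygon h3 c hw
  obtain ⟨B, hs0, hs1, hB⟩ := exists_mirrorPair_regularPolygon n hn h3 c w hw i
  refine ⟨B.net hp h3, B.curve, 2 * B.h, B.isClosedGeodesic_curve hp h3, B.curve_zero,
    B.curve_ne_conePoint hp h3, fun s hs t ht => B.curve_eq_curve_iff hp h3 hs ht, fun _ => rfl,
    fun t _ => ⟨?_, ?_⟩, ?_, ?_, B.curve_not_joinSmoothly hp h3, fun t => ?_⟩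
  · change B.curve (2 * B.h * ((0 : ℕ) : ℝ) + t) = _
    rw [Nat.cast_zero, mul_zero, zero_add]
  · change B.curve (2 * B.h * ((1 : ℕ) : ℝ) + t) = _
    rw [Nat.cast_one, mul_one]
  · have := B.curve_crossesPerpendicularly 0
    rw [show MirrorPair.loopDir 0 = false from rfl, hs0] at this
    rwa [show 2 * B.h * ((0 : ℤ) : ℝ) + B.h = 2 * B.h / 2 by push_cast; ring] at this
  · have := B.curve_crossesPerpendicularly 1
    rw [show MirrorPair.loopDir 1 = true from rfl, hs1] at this
    rwa [show 2 * B.h * ((1 : ℤ) : ℝ) + B.h = 2 * B.h + 2 * B.h / 2 by push_cast; ring] at this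
  · obtain ⟨b, s, ρ, h0, h1, e1, e2⟩ := B.exists_curve_eq_arc t
    exact ⟨s, ⟨_, B.point_mem_region b h0 h1⟩, ⟨_, B.point_mem_region (!b) h0 h1⟩,
      e1.trans (facePoint_of_mem _ _), e2.trans (facePoint_of_mem _ _), (hB b ρ).symm⟩
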